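/- Let $T>0$ and let $(\Omega,\mathcal F,(\mathcal F_t)_{t\ge 0},\mathbb P)$ be a filtered probability space. Let $0<\tau_1<\tau_2<\dots$ be stopping times, almost surely only finitely many of them in $[0,T]$. Each arrival $i$ has a type $\varepsilon_i\in\{+,-\}$ and a size $J_i>0$, both $\mathcal F_{\tau_i}$-measurable, and the $J_i$ are i.i.d. with the law $\mu_J$ of a random variable $J$ with $\mathbb E(J^2)<\infty$. For a function $h$ write $$\int_0^t h(s)J_s\,dN^{\pm}_s=\sum_{i:\ \varepsilon_i=\pm,\ \tau_i\le t}h(\tau_i)J_i .$$ Let $\mu_0,\kappa,\alpha,\beta>0$ with $\alpha\,\mathbb E(J)<\beta$, and put, for $t\in[0,T]$, $$\lambda^{+}_t=\mu_0e^{\kappa t/T}+\int_0^t\alpha e^{-\beta(t-s)}J_s\,dN^-_s,\qquad \lambda^{-}_t=\mu_0e^{\kappa t/T}+\int_0^t\alpha e^{-\beta(t-s)}J_s\,dN^+_s .$$ Assume that $(\tau_i,\varepsilon_i,J_i)_{i\ge1}$ is a bivariate marked Hawkes process on $[0,T]$ with intensity $(\lambda^+,\lambda^-)$ and jump law $\mu_J$,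 that is, the random measure $N^{\pm}(dt,dx)=\sum_{i:\,\varepsilon_i=\pm}\delta_{(\tau_i,J_i)}(dt,dx)$ has the $(\mathcal F_t)$-compensator $\lambda^{\pm}_t\,dt\otimes\mu_J(dx)$ on $[0,T]\times\mathbb R_+$. Let $f_0\in\mathbb R$ and let the price be $$f_t=f_0+\int_0^tJ_s\,dN^+_s-\int_0^tJ_s\,dN^-_s .$$ Then for every $t\in[0,T]$ the variable $f_t$ is square integrable and $$\mathbb E(f_t^2)=f_0^2+2\mu_0\mathbb E(J^2)\Big((C_1+C_2+C_3+C_4)e^{\kappa t/T}-C_1e^{-(\beta-\alpha\mathbb E(J))t}-C_2e^{-2(\beta+\alpha\mathbb E(J))t}-C_3e^{-(\beta+\alpha\mathbb E(J))t}-C_4\Big),$$ where $$C_1=\frac{-\alpha^2\mathbb E(J)^2}{(\beta-\alpha\mathbb E(J))(\beta+3\alpha\mathbb E(J))(\beta-\alpha\mathbb E(J)+\frac{\kappa}{T})},\qquad C_2=\frac{\alpha^2\mathbb E(J)^2(\beta+2\alpha\mathbb E(J))}{(\beta+\alpha\mathbb E(J))^2(\beta+3\alpha\mathbb E(J))(2\beta+2\alpha\mathbb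 E(J)+\frac{\kappa}{T})},$$ $$C_3=\frac{\alpha\beta\,\mathbb E(J)}{(\beta+\alpha\mathbb E(J))^2(\beta+\alpha\mathbb E(J)+\frac{\kappa}{T})},\qquad C_4=\frac{\beta^3}{\frac{\kappa}{T}(\beta+\alpha\mathbb E(J))^2(\beta-\alpha\mathbb E(J))}.$$ -/

import Mathlib

open MeasureTheory ProbabilityTheory
open scoped NNReal ENNReal

namespace MarkedHawkes

variable {Ω : Type*}

/-- The integral `∫₀ᵗ h(s) J_s dN^m_s` against the marked point process of type `m`, that is the sum
of `h(τ_i) J_i` over the arrivals `i` of type `m` with `τ_i ≤ t`. Arrival `i` happens at time `τ i`,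
has type `ε i` (`0` for an upward move `+`, `1` for a downward move `-`) and size `J i`. -/
noncomputable def markIntegral (τ : ℕ → Ω → ℝ≥0) (ε : ℕ → Ω → Fin 2) (J : ℕ → Ω → ℝ)
    (h : ℝ → ℝ) (m : Fin 2) (t : ℝ) (ω : Ω) : ℝ :=
  ∑' i, if ε i ω = m ∧ (τ i ω : ℝ) ≤ t then h (τ i ω) * J i ω else 0

/-- The intensity `λ^m_t = μ(t/T) + ∑ n, ∫₀ᵗ φ_{m n}(t - s) J_s dN^n_s`. -/
noncomputable def intensity (T : ℝ≥0) (μ : ℝ → ℝ) (φ : ℝ → Matrix (Fin 2) (Fin 2) ℝ)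
    (τ : ℕ → Ω → ℝ≥0) (ε : ℕ → Ω → Fin 2) (J : ℕ → Ω → ℝ)
    (m : Fin 2) (t : ℝ) (ω : Ω) : ℝ :=
  μ (t / T) + ∑ n, markIntegral τ ε J (fun s => φ (t - s) m n) n t ω

/-- The accumulated upward (`m = 0`) or downward (`m = 1`) moves, `∫₀ᵗ J_s dN^m_s`. -/
noncomputable def moves (τ : ℕ → Ω → ℝ≥0) (ε : ℕ → Ω → Fin 2) (J : ℕ → Ω → ℝ)
    (m : Fin 2) (t : ℝ) (ω : Ω) : ℝ :=
  markIntegral τ ε J (fun _ => 1) m t ω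

/-- The price `f_t = f₀ + f⁺_t - f⁻_t`. -/
noncomputable def price (f₀ : ℝ) (τ : ℕ → Ω → ℝ≥0) (ε : ℕ → Ω → Fin 2) (J : ℕ → Ω → ℝ)
    (t : ℝ) (ω : Ω) : ℝ :=
  f₀ + moves τ ε J 0 t ω - moves τ ε J 1 t ω

/-- `(τ, ε, J)` is, on the horizon `[0, T]`, a bivariate marked Hawkes process for the filtration
`𝓕`, with baseline `μ(·/T)`, excitation matrix `φ` and jump sizes distributed as `X`. -/
structure IsMarkedHawkes [MeasurableSpace Ω] (P : Measure Ω)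
    (𝓕 : Filtration ℝ≥0 ‹MeasurableSpace Ω›)
    (T : ℝ≥0) (μ : ℝ → ℝ) (φ : ℝ → Matrix (Fin 2) (Fin 2) ℝ) (X : Ω → ℝ)
    (τ : ℕ → Ω → ℝ≥0) (ε : ℕ → Ω → Fin 2) (J : ℕ → Ω → ℝ) : Prop where
  /-- The arrival times are positive. -/
  arrival_pos : ∀ i ω, 0 < τ i ω
  /-- The arrival times are strictly increasing. -/
  arrival_strictMono : ∀ ω, StrictMono fun i => τ i ω
  /-- Almost surely there are finitely many arrivals up to time `T`. -/
  locally_finite : ∀ᵐ ω ∂P, {i | τ i ω ≤ T}.Finite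
  /-- The arrival times are stopping times. -/
  isStoppingTime : ∀ i, IsStoppingTime 𝓕 fun ω => (τ i ω : WithTop ℝ≥0)
  /-- The type of an arrival is known at that arrival. -/
  measurable_type : ∀ i, Measurable[(isStoppingTime i).measurableSpace] (ε i)
  /-- The jump size of an arrival is known at that arrival. -/
  measurable_size : ∀ i, Measurable[(isStoppingTime i).measurableSpace] (J i)
  /-- The jump sizes are positive. -/
  size_pos : ∀ i ω, 0 < J i ω
  /-- The jump sizes are independent. -/
  size_indep : iIndepFun J P
  /-- The jump sizes are distributed as `X`. -/
  size_identDistrib : ∀ i, IdentDistrib (J i) X P P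
  /-- The random measure `N^m(dt, dx) = ∑ δ_(τ_i, J_i)` of the arrivals of type `m` has the
  compensator `λ^m_t dt ⊗ Law(X)(dx)` on `[0, T]`: the expected integrals of every nonnegative
  predictable function against the two agree. -/
  compensator : ∀ (m : Fin 2) (H : (ℝ≥0 × Ω) × ℝ → ℝ≥0∞),
    Measurable[(𝓕.predictable).prod (borel ℝ)] H →
    ∫⁻ ω, ∑' i, (if ε i ω = m ∧ τ i ω ≤ T then H ((τ i ω, ω), J i ω) else 0) ∂P =
      ∫⁻ ω, ∫⁻ t in Set.Icc (0 : ℝ) T,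
        ENNReal.ofReal (intensity T μ φ τ ε J m t ω) *
          ∫⁻ x, H ((t.toNNReal, ω), x) ∂(P.map X) ∂volume ∂P

/-- The exponential baseline `μ(u) = μ₀ e^{κ u}`. -/
noncomputable def expBaseline (μ₀ κ : ℝ) (u : ℝ) : ℝ := μ₀ * Real.exp (κ * u)

/-- The purely mutual excitation matrix with off-diagonal entries `α e^{-β t}`. -/
noncomputable def expExcitation (α β : ℝ) (t : ℝ) : Matrix (Fin 2) (Fin 2) ℝ :=
  !![0, α * Real.exp (-β * t); α * Real.exp (-β * t), 0]

end MarkedHawkes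

namespace MarkedHawkes

variable {Ω : Type*}

/-! Write `S_b` for the sum of `e^{b s} J_s` over the up arrivals minus the same sum over the down
arrivals, `a = α E(J)`, `c = κ/T`. The kernel factors as `e^{-β(t-s)} = e^{-βt} e^{βs}`, so the
excitation is carried by the exponent `b = β` and the price by `b = 0`. The baseline cancels in `λ⁺
- λ⁻ = -α e^{-βt} S_β`. Hence the second moments of `S_β S_β`, `S_β S_0` and `S_0 S_0` form a
triangular linear system, driven only by `E(J²)` times the mean total intensity, and that mean
solves a scalar linear equation of its own. Solving the four equations in turn gives sums of
exponentials; matching coefficients yields the constants `C₁, ..., C₄`. The linear term in `f₀`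
vanishes because up and down moves have equal means.

To justify the equations, sums over arrivals are taken in `ℝ≥0∞`, where the compensator identity
needs no integrability. Integration by parts (`marks_mul_marks`) writes a product of two sums as a
sum over arrivals of predictable left limits plus a diagonal of squared sizes;
`IsMarkedHawkes.lintegral_tsum_arrivals` then turns expectations into time integrals
(`IsMarkedHawkes.lintegral_marks_mul_marks`).

Passing to real numbers requires finite second moments. `IsMarkedHawkes.exists_lintegral_sq_le`
obtains them by stopping at the `n`-th arrival, applying Grönwall with a constant independent of
`n`, and letting `n` grow. With boundedness known, `eq_of_eq_integral` identifies each moment with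
the explicit solution of its equation. -/

/-- The extended nonnegative sum `∑ a(ε_i, τ_i) J_i` over the arrivals up to time `t`. -/
noncomputable def marks (τ : ℕ → Ω → ℝ≥0) (ε : ℕ → Ω → Fin 2) (J : ℕ → Ω → ℝ)
    (a : Fin 2 → ℝ → ℝ≥0∞) (t : ℝ) (ω : Ω) : ℝ≥0∞ :=
  ∑' i, if (τ i ω : ℝ) ≤ t then a (ε i ω) (τ i ω) * ENNReal.ofReal (J i ω) else 0

/-- The extended nonnegative sum `∑ a(ε_i, τ_i) J_i` over the arrivals strictly before time `t`. -/
noncomputable def marksLeft (τ : ℕ → Ω → ℝ≥0) (ε : ℕ → Ω → Fin 2) (J : ℕ → Ω → ℝ)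
    (a : Fin 2 → ℝ → ℝ≥0∞) (t : ℝ) (ω : Ω) : ℝ≥0∞ :=
  ∑' i, if (τ i ω : ℝ) < t then a (ε i ω) (τ i ω) * ENNReal.ofReal (J i ω) else 0

/-! ### Predictability of sums over strictly earlier arrivals. -/

section Predictable

variable [mΩ : MeasurableSpace Ω] {𝓕 : Filtration ℝ≥0 mΩ}

lemma measurable_fst_predictable : Measurable[𝓕.predictable] (Prod.fst : ℝ≥0 × Ω → ℝ≥0) := by
  refine @measurable_of_Ioi _ _ _ _ _ 𝓕.predictable _ _ _ _ fun x => ?_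
  convert measurableSet_predictable_Ioi_prod (𝓕 := 𝓕) (i := x) (s := Set.univ) MeasurableSet.univ
    using 1
  ext p
  simp

/-- A rational `q` with `σ ≤ q < t` writes the set as a countable union of rectangles `(q, ∞) × (A ∩
{σ ≤ q})`, whose bases lie in `𝓕 q` by the definition of the stopped σ-algebra. -/
lemma measurableSet_predictable_lt {σ : Ω → ℝ≥0}
    (hσ : IsStoppingTime 𝓕 fun ω => (σ ω : WithTop ℝ≥0)) {A : Set Ω}
    (hA : MeasurableSet[hσ.measurableSpace] A) :
    MeasurableSet[𝓕.predictable] {p : ℝ≥0 × Ω | σ p.2 < p.1 ∧ p.2 ∈ A} := by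
  have h : {p : ℝ≥0 × Ω | σ p.2 < p.1 ∧ p.2 ∈ A} =
      ⋃ q : ℚ≥0, Set.Ioi (q : ℝ≥0) ×ˢ (A ∩ {ω | (σ ω : WithTop ℝ≥0) ≤ ((q : ℝ≥0) : ℝ≥0)}) := by
    ext p
    simp only [Set.mem_ofPred_eq, Set.mem_iUnion, Set.mem_prod, Set.mem_Ioi, Set.mem_inter_iff,
      WithTop.coe_le_coe]
    constructor
    · rintro ⟨h1, h2⟩
      obtain ⟨q, hq1, hq2⟩ := exists_rat_btwn (NNReal.coe_lt_coe.2 h1)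
      have hq0 : 0 ≤ q := by
        have : (0 : ℝ) ≤ q := (σ p.2).2.trans hq1.le
        exact_mod_cast this
      lift q to ℚ≥0 using hq0
      refine ⟨q, ?_, h2, ?_⟩
      · exact NNReal.coe_lt_coe.1 (by exact_mod_cast hq2)
      · exact NNReal.coe_le_coe.1 (by exact_mod_cast hq1.le)
    · rintro ⟨q, h1, h2, h3⟩
      exact ⟨h3.trans_lt h1, h2⟩
  rw [h]
  exact @MeasurableSet.iUnion _ _ 𝓕.predictable _ _ fun q =>
    measurableSet_predictable_Ioi_prod (hA.2 q)

lemma measurable_predictable_ite_lt {σ : Ω → ℝ≥0}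
    (hσ : IsStoppingTime 𝓕 fun ω => (σ ω : WithTop ℝ≥0)) {g : Ω → ℝ≥0∞}
    (hg : Measurable[hσ.measurableSpace] g) :
    Measurable[𝓕.predictable] fun p : ℝ≥0 × Ω => if σ p.2 < p.1 then g p.2 else 0 := by
  intro B hB
  have hU := measurableSet_predictable_lt hσ (@MeasurableSet.univ _ hσ.measurableSpace)
  have h : (fun p : ℝ≥0 × Ω => if σ p.2 < p.1 then g p.2 else 0) ⁻¹' B =
      {p : ℝ≥0 × Ω | σ p.2 < p.1 ∧ p.2 ∈ g ⁻¹' B} ∪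
        ({p : ℝ≥0 × Ω | σ p.2 < p.1 ∧ p.2 ∈ Set.univ}ᶜ ∩ {_p : ℝ≥0 × Ω | (0 : ℝ≥0∞) ∈ B}) := by
    ext p
    by_cases hp : σ p.2 < p.1 <;> simp [hp]
  rw [h]
  exact @MeasurableSet.union _ 𝓕.predictable _ _ (measurableSet_predictable_lt hσ (hg hB))
    (@MeasurableSet.inter _ 𝓕.predictable _ _ (@MeasurableSet.compl _ _ 𝓕.predictable hU)
      (@MeasurableSet.const _ 𝓕.predictable _))

lemma measurableSet_predictable_le {σ : Ω → ℝ≥0}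
    (hσ : IsStoppingTime 𝓕 fun ω => (σ ω : WithTop ℝ≥0)) :
    MeasurableSet[𝓕.predictable] {p : ℝ≥0 × Ω | p.1 ≤ σ p.2} := by
  convert @MeasurableSet.compl _ _ 𝓕.predictable
    (measurableSet_predictable_lt hσ (@MeasurableSet.univ _ hσ.measurableSpace)) using 1
  ext p
  simp

lemma measurable_stopping_self {σ : Ω → ℝ≥0}
    (hσ : IsStoppingTime 𝓕 fun ω => (σ ω : WithTop ℝ≥0)) :
    Measurable[hσ.measurableSpace] σ := by
  refine @measurable_of_Iic _ _ _ _ _ hσ.measurableSpace _ _ _ _ fun x => ?_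
  convert hσ.measurableSet_le' x using 1
  ext ω
  exact (WithTop.coe_le_coe (a := x) (b := σ ω)).symm

omit mΩ in
lemma measurable_apply_fin {S : MeasurableSpace Ω} {e : Ω → Fin 2} {σ : Ω → ℝ≥0}
    {a : Fin 2 → ℝ → ℝ≥0∞} (ha : ∀ m, Measurable (a m)) (he : Measurable[S] e)
    (hσ : Measurable[S] σ) : Measurable[S] fun ω => a (e ω) (σ ω) := by
  have h : Measurable (Function.uncurry a) := measurable_from_prod_countable_right ha
  exact h.comp (he.prodMk (measurable_subtype_coe.comp hσ))

/-- The strict inequality is what makes this work: each summand switches on just after its arrival,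
when type and size are already known. This is why integration by parts is phrased with `marksLeft`.
-/
lemma measurable_predictable_marksLeft {τ : ℕ → Ω → ℝ≥0} {ε : ℕ → Ω → Fin 2} {J : ℕ → Ω → ℝ}
    (hτ : ∀ i, IsStoppingTime 𝓕 fun ω => (τ i ω : WithTop ℝ≥0))
    (hε : ∀ i, Measurable[(hτ i).measurableSpace] (ε i))
    (hJ : ∀ i, Measurable[(hτ i).measurableSpace] (J i))
    {a : Fin 2 → ℝ → ℝ≥0∞} (ha : ∀ m, Measurable (a m)) :
    Measurable[𝓕.predictable] fun p : ℝ≥0 × Ω => marksLeft τ ε J a p.1 p.2 := by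
  unfold marksLeft
  simp_rw [NNReal.coe_lt_coe]
  refine @Measurable.tsum _ _ _ 𝓕.predictable _ _ _ _ _ _ _ _ _ _ _ _ fun i => ?_
  refine measurable_predictable_ite_lt (hτ i)
    (g := fun ω => a (ε i ω) (τ i ω) * ENNReal.ofReal (J i ω)) ?_
  exact (measurable_apply_fin ha (hε i) (measurable_stopping_self (hτ i))).mul
    (ENNReal.measurable_ofReal.comp (hJ i))

end Predictable

/-! ### Pathwise algebra of sums over arrivals. -/

section Pathwise

variable {τ : ℕ → Ω → ℝ≥0} {ε : ℕ → Ω → Fin 2} {J : ℕ → Ω → ℝ}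

/-- The double sum is cut into the parts below, above and on the diagonal. -/
lemma tsum_mul_tsum_eq (x y : ℕ → ℝ≥0∞) :
    (∑' i, x i) * ∑' j, y j = ∑' i, (x i * (∑' j, if j < i then y j else 0) +
      y i * (∑' j, if j < i then x j else 0) + x i * y i) := by
  have h1 : ∀ i, x i * ∑' j, y j = x i * (∑' j, if j < i then y j else 0) +
      x i * (∑' j, if i < j then y j else 0) + x i * y i := by
    intro i
    rw [← mul_add, ← mul_add]
    congr 1
    have : y i = ∑' j, if j = i then y j else 0 := by
      rw [tsum_eq_single i (by simp +contextual)]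
      simp
    rw [this, ← ENNReal.tsum_add, ← ENNReal.tsum_add]
    refine tsum_congr fun j => ?_
    rcases lt_trichotomy j i with h | h | h
    · simp [h, h.ne, h.not_gt]
    · simp [h]
    · simp [h, h.ne', h.not_gt]
  -- Tonelli turns the part above the diagonal into one below it with the roles of `x` and `y`
  -- exchanged.
  have h2 : ∑' i, x i * (∑' j, if i < j then y j else 0) =
      ∑' i, y i * (∑' j, if j < i then x j else 0) := by
    simp_rw [← ENNReal.tsum_mul_left]
    rw [ENNReal.tsum_comm]
    refine tsum_congr fun i => tsum_congr fun j => ?_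
    split_ifs <;> ring
  rw [← ENNReal.tsum_mul_right]
  simp_rw [h1, ENNReal.tsum_add]
  rw [h2]

/-- Integration by parts for the sums over the arrivals. -/
lemma marks_mul_marks {ω : Ω} (hτ : StrictMono fun i => τ i ω) (a b : Fin 2 → ℝ → ℝ≥0∞) (t : ℝ) :
    marks τ ε J a t ω * marks τ ε J b t ω = ∑' i, if (τ i ω : ℝ) ≤ t then
      (a (ε i ω) (τ i ω) * marksLeft τ ε J b (τ i ω) ω +
        b (ε i ω) (τ i ω) * marksLeft τ ε J a (τ i ω) ω) * ENNReal.ofReal (J i ω) +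
      a (ε i ω) (τ i ω) * b (ε i ω) (τ i ω) * ENNReal.ofReal (J i ω) ^ 2 else 0 := by
  have key : ∀ (c : Fin 2 → ℝ → ℝ≥0∞) (i : ℕ), (τ i ω : ℝ) ≤ t →
      (∑' j, if j < i then (if (τ j ω : ℝ) ≤ t then
        c (ε j ω) (τ j ω) * ENNReal.ofReal (J j ω) else 0) else 0) =
      marksLeft τ ε J c (τ i ω) ω := by
    intro c i hi
    refine tsum_congr fun j => ?_
    -- Arrival times increase strictly, so earlier index and earlier time mean the same.
    have hij : (τ j ω : ℝ) < τ i ω ↔ j < i := by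
      rw [NNReal.coe_lt_coe]; exact hτ.lt_iff_lt
    by_cases h : j < i
    · rw [if_pos h, if_pos (hij.2 h), if_pos ((hij.2 h).le.trans hi)]
    · rw [if_neg h, if_neg (mt hij.1 h)]
  unfold marks
  rw [tsum_mul_tsum_eq]
  refine tsum_congr fun i => ?_
  by_cases hi : (τ i ω : ℝ) ≤ t
  · rw [key a i hi, key b i hi]
    simp only [if_pos hi]
    ring
  · simp [hi]

lemma marks_mul_const (c : ℝ≥0∞) (a : Fin 2 → ℝ → ℝ≥0∞) (t : ℝ) (ω : Ω) :
    marks τ ε J (fun m s => c * a m s) t ω = c * marks τ ε J a t ω := by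
  unfold marks
  rw [← ENNReal.tsum_mul_left]
  refine tsum_congr fun i => ?_
  split_ifs <;> ring

lemma marks_le_marks {a b : Fin 2 → ℝ → ℝ≥0∞} {t : ℝ} (h : ∀ m, ∀ s ∈ Set.Icc 0 t, a m s ≤ b m s)
    (ω : Ω) : marks τ ε J a t ω ≤ marks τ ε J b t ω := by
  refine ENNReal.tsum_le_tsum fun i => ?_
  by_cases hi : (τ i ω : ℝ) ≤ t
  · simp only [if_pos hi]
    gcongr
    exact h _ _ ⟨NNReal.coe_nonneg _, hi⟩
  · simp [hi]

lemma measurable_marks [MeasurableSpace Ω] (hτ : ∀ i, Measurable (τ i)) (hε : ∀ i, Measurable (ε i))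
    (hJ : ∀ i, Measurable (J i)) {a : Fin 2 → ℝ → ℝ≥0∞} (ha : ∀ m, Measurable (a m)) :
    Measurable fun p : ℝ × Ω => marks τ ε J a p.1 p.2 := by
  unfold marks
  refine Measurable.tsum fun i => ?_
  refine Measurable.ite (measurableSet_le ?_ measurable_fst) ?_ measurable_const
  · exact measurable_subtype_coe.comp ((hτ i).comp measurable_snd)
  · exact (measurable_apply_fin ha ((hε i).comp measurable_snd) ((hτ i).comp measurable_snd)).mul
      (ENNReal.measurable_ofReal.comp ((hJ i).comp measurable_snd))

end Pathwise

end MarkedHawkes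

/-! ### The exponential intensity and the compensator formula. -/

namespace MarkedHawkes

variable {Ω : Type*}

/-- The weight that counts an arrival of type `m` at time `s` with the factor `e^{b s}`. -/
noncomputable def expWeight (b : ℝ) (m : Fin 2) : Fin 2 → ℝ → ℝ≥0∞ :=
  fun n s => if n = m then ENNReal.ofReal (Real.exp (b * s)) else 0

lemma measurable_expWeight (b : ℝ) (m n : Fin 2) : Measurable (expWeight b m n) := by
  unfold expWeight
  split_ifs <;> fun_prop

/-- The intensity of the arrivals of type `m` as an extended nonnegative number. -/
noncomputable def rate (T : ℝ≥0) (μ₀ κ α β : ℝ) (τ : ℕ → Ω → ℝ≥0) (ε : ℕ → Ω → Fin 2)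
    (J : ℕ → Ω → ℝ) (m : Fin 2) (t : ℝ) (ω : Ω) : ℝ≥0∞ :=
  ENNReal.ofReal (μ₀ * Real.exp (κ * (t / T))) +
    ENNReal.ofReal (α * Real.exp (-β * t)) * marks τ ε J (expWeight β (1 - m)) t ω

section Pathwise

variable {τ : ℕ → Ω → ℝ≥0} {ε : ℕ → Ω → Fin 2} {J : ℕ → Ω → ℝ} {T : ℝ≥0} {ω : Ω} {t : ℝ}

lemma finite_support_of_le (hfin : {i | τ i ω ≤ T}.Finite) (ht : t ≤ T) {E : Type*} [Zero E]
    (p : ℕ → Prop) [DecidablePred p] (x : ℕ → E) :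
    (Function.support fun i => if p i ∧ (τ i ω : ℝ) ≤ t then x i else 0).Finite := by
  refine hfin.subset fun i hi => ?_
  rw [Function.mem_support] at hi
  have h : p i ∧ (τ i ω : ℝ) ≤ t := by
    by_contra h
    exact hi (if_neg h)
  exact NNReal.coe_le_coe.1 (h.2.trans ht)

lemma markIntegral_nonneg (hJ : ∀ i, 0 < J i ω) {h : ℝ → ℝ} (hh : ∀ s, 0 ≤ h s) (m : Fin 2) :
    0 ≤ markIntegral τ ε J h m t ω := by
  refine tsum_nonneg fun i => ?_
  split_ifs
  exacts [mul_nonneg (hh _) (hJ i).le, le_rfl]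

/-- Finitely many arrivals make the real series summable; without this its default value `0` could
differ from the extended sum. -/
lemma ofReal_markIntegral (hfin : {i | τ i ω ≤ T}.Finite) (ht : t ≤ T) (hJ : ∀ i, 0 < J i ω)
    {h : ℝ → ℝ} (hh : ∀ s, 0 ≤ h s) (m : Fin 2) :
    ENNReal.ofReal (markIntegral τ ε J h m t ω) =
      marks τ ε J (fun n s => if n = m then ENNReal.ofReal (h s) else 0) t ω := by
  unfold markIntegral marks
  rw [ENNReal.ofReal_tsum_of_nonneg]
  · refine tsum_congr fun i => ?_
    by_cases h1 : ε i ω = m <;> by_cases h2 : (τ i ω : ℝ) ≤ t <;>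
      simp [h1, h2, ENNReal.ofReal_mul (hh _)]
  · intro i
    split_ifs
    exacts [mul_nonneg (hh _) (hJ i).le, le_rfl]
  · exact summable_of_hasFiniteSupport (finite_support_of_le hfin ht _ _)

/-- Excitation is purely mutual, so only the opposite type `1 - m` contributes, and `e^{-β(t-s)}`
splits into a factor in `t` and a weight in `s`. -/
lemma ofReal_intensity (hfin : {i | τ i ω ≤ T}.Finite) (ht : t ≤ T) (hJ : ∀ i, 0 < J i ω)
    {μ₀ κ α β : ℝ} (hμ₀ : 0 < μ₀) (hα : 0 < α) (m : Fin 2) :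
    ENNReal.ofReal (intensity T (expBaseline μ₀ κ) (expExcitation α β) τ ε J m t ω) =
      rate T μ₀ κ α β τ ε J m t ω := by
  have key : ∀ n : Fin 2, markIntegral τ ε J (fun _ => 0) n t ω = 0 := by
    intro n
    simp [markIntegral]
  have hnn : ∀ s : ℝ, 0 ≤ α * Real.exp (-β * (t - s)) := fun s => by positivity
  have h : intensity T (expBaseline μ₀ κ) (expExcitation α β) τ ε J m t ω =
      μ₀ * Real.exp (κ * (t / T)) +
        markIntegral τ ε J (fun s => α * Real.exp (-β * (t - s))) (1 - m) t ω := by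
    unfold intensity expBaseline expExcitation
    fin_cases m <;> simp [key]
  rw [h, ENNReal.ofReal_add (by positivity) (markIntegral_nonneg hJ hnn _),
    ofReal_markIntegral hfin ht hJ hnn, rate, ← marks_mul_const]
  congr 2
  ext n s
  unfold expWeight
  split_ifs
  · rw [← ENNReal.ofReal_mul (by positivity), mul_assoc, ← Real.exp_add]
    ring_nf
  · simp

end Pathwise

section Compensator

variable [mΩ : MeasurableSpace Ω] {P : Measure Ω} {𝓕 : Filtration ℝ≥0 mΩ} {T : ℝ≥0}
  {μ₀ κ α β : ℝ} {X : Ω → ℝ} {τ : ℕ → Ω → ℝ≥0} {ε : ℕ → Ω → Fin 2} {J : ℕ → Ω → ℝ}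

lemma predictable_le_prod : 𝓕.predictable ≤ (inferInstance : MeasurableSpace (ℝ≥0 × Ω)) := by
  refine MeasurableSpace.generateFrom_le ?_
  rintro _ (⟨A, hA, rfl⟩ | ⟨i, A, hA, rfl⟩)
  · exact (measurableSet_singleton _).prod (𝓕.le _ _ hA)
  · exact measurableSet_Ioi.prod (𝓕.le _ _ hA)

section

variable {μ : ℝ → ℝ} {φ : ℝ → Matrix (Fin 2) (Fin 2) ℝ}
  (hN : IsMarkedHawkes P 𝓕 T μ φ X τ ε J)

include hN

lemma IsMarkedHawkes.measurable_arrival (i : ℕ) : Measurable (τ i) :=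
  (measurable_stopping_self (hN.isStoppingTime i)).mono (hN.isStoppingTime i).measurableSpace_le
    le_rfl

lemma IsMarkedHawkes.measurable_kind (i : ℕ) : Measurable (ε i) :=
  (hN.measurable_type i).mono (hN.isStoppingTime i).measurableSpace_le le_rfl

lemma IsMarkedHawkes.measurable_jump (i : ℕ) : Measurable (J i) :=
  (hN.measurable_size i).mono (hN.isStoppingTime i).measurableSpace_le le_rfl

lemma IsMarkedHawkes.measurable_marks {a : Fin 2 → ℝ → ℝ≥0∞} (ha : ∀ m, Measurable (a m)) :
    Measurable fun p : ℝ × Ω => marks τ ε J a p.1 p.2 :=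
  MarkedHawkes.measurable_marks hN.measurable_arrival hN.measurable_kind hN.measurable_jump ha

lemma IsMarkedHawkes.measurable_rate (m : Fin 2) :
    Measurable fun p : ℝ × Ω => rate T μ₀ κ α β τ ε J m p.1 p.2 := by
  unfold rate
  have := hN.measurable_marks (measurable_expWeight β (1 - m))
  fun_prop

end

lemma lintegral_const_mul_swap [SFinite P] {f : ℝ × Ω → ℝ≥0∞} (hf : Measurable f) (c : ℝ≥0∞)
    (ν : Measure ℝ) [SFinite ν] :
    ∫⁻ ω, ∫⁻ s, c * f (s, ω) ∂ν ∂P = c * ∫⁻ s, ∫⁻ ω, f (s, ω) ∂P ∂ν := by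
  rw [lintegral_lintegral_swap ((hf.comp measurable_swap).const_mul c).aemeasurable,
    ← lintegral_const_mul _ hf.lintegral_prod_right']
  exact lintegral_congr fun s => lintegral_const_mul _ (hf.comp measurable_prodMk_left)

/-- The compensator formula for integrands `K(s, ω) g(x)` with `K` predictable. -/
theorem IsMarkedHawkes.lintegral_tsum_arrivals [SFinite P] (hμ₀ : 0 < μ₀) (hα : 0 < α)
    (hX : AEMeasurable X P)
    (hN : IsMarkedHawkes P 𝓕 T (expBaseline μ₀ κ) (expExcitation α β) X τ ε J)
    {K : Fin 2 → ℝ≥0 × Ω → ℝ≥0∞} (hK : ∀ m, Measurable[𝓕.predictable] (K m))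
    {g : ℝ → ℝ≥0∞} (hg : Measurable g) {t : ℝ} (ht : t ≤ T) :
    ∫⁻ ω, ∑' i, (if (τ i ω : ℝ) ≤ t then K (ε i ω) (τ i ω, ω) * g (J i ω) else 0) ∂P =
      (∫⁻ ω, g (X ω) ∂P) * ∑ m, ∫⁻ s in Set.Icc 0 t, ∫⁻ ω,
        rate T μ₀ κ α β τ ε J m s ω * K m (s.toNNReal, ω) ∂P := by
  have hK' : ∀ m, Measurable (K m) := fun m => (hK m).mono predictable_le_prod le_rfl
  have hJm := hN.measurable_jump
  have hτm := hN.measurable_arrival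
  have hεm := hN.measurable_kind
  have hKs : ∀ m, Measurable fun p : ℝ × Ω => K m (p.1.toNNReal, p.2) := fun m =>
    (hK' m).comp ((measurable_real_toNNReal.comp measurable_fst).prodMk measurable_snd)
  have hr : ∀ m, Measurable fun p : ℝ × Ω => rate T μ₀ κ α β τ ε J m p.1 p.2 := fun m =>
    hN.measurable_rate m
  -- The cutoff at `t` is moved into the integrand, as a deterministic indicator that keeps it
  -- predictable, because the compensator identity is stated on all of `[0, T]`.
  have hsplit : ∀ ω, ∑' i, (if (τ i ω : ℝ) ≤ t then K (ε i ω) (τ i ω, ω) * g (J i ω) else 0) =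
      ∑ m, ∑' i, if ε i ω = m ∧ τ i ω ≤ T then
        (if ((τ i ω : ℝ≥0) : ℝ) ≤ t then K m (τ i ω, ω) else 0) * g (J i ω) else 0 := by
    intro ω
    rw [← Summable.tsum_finsetSum fun _ _ => ENNReal.summable]
    refine tsum_congr fun i => ?_
    by_cases h : (τ i ω : ℝ) ≤ t
    · have h2 : τ i ω ≤ T := NNReal.coe_le_coe.1 (h.trans ht)
      simp [h, h2]
    · simp [h]
  simp_rw [hsplit]
  rw [lintegral_finsetSum]
  swap
  · intro m _
    refine Measurable.tsum fun i => ?_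
    refine Measurable.ite ?_ (Measurable.mul (Measurable.ite ?_ ?_ measurable_const) ?_)
      measurable_const
    · exact (hεm i (measurableSet_singleton m)).inter
        (measurableSet_le (hτm i) measurable_const : MeasurableSet {ω | τ i ω ≤ T})
    · exact measurableSet_le (measurable_subtype_coe.comp (hτm i)) measurable_const
    · exact (hK' m).comp ((hτm i).prodMk measurable_id)
    · exact hg.comp (hJm i)
  rw [Finset.mul_sum]
  refine Finset.sum_congr rfl fun m _ => ?_
  have hH : Measurable[(𝓕.predictable).prod (borel ℝ)] fun p : (ℝ≥0 × Ω) × ℝ =>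
      (if ((p.1.1 : ℝ≥0) : ℝ) ≤ t then K m p.1 else 0) * g p.2 := by
    let _ : MeasurableSpace (ℝ≥0 × Ω) := 𝓕.predictable
    have e : (borel ℝ) = (inferInstance : MeasurableSpace ℝ) := BorelSpace.measurable_eq.symm
    rw [e]
    have h1 : Measurable fun p : ℝ≥0 × Ω => if ((p.1 : ℝ≥0) : ℝ) ≤ t then K m p else 0 := by
      refine Measurable.ite ?_ (hK m) measurable_const
      exact measurableSet_le (measurable_subtype_coe.comp measurable_fst_predictable)
        measurable_const
    exact (h1.comp measurable_fst).mul (hg.comp measurable_snd)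
  rw [hN.compensator m _ hH]
  have hmap : ∀ k : ℝ≥0∞, ∫⁻ x, k * g x ∂(P.map X) = k * ∫⁻ ω, g (X ω) ∂P := by
    intro k
    rw [lintegral_const_mul _ hg, lintegral_map' hg.aemeasurable hX]
  simp_rw [hmap]
  have hind : ∀ᵐ ω ∂P, ∫⁻ s in Set.Icc (0 : ℝ) T,
      ENNReal.ofReal (intensity T (expBaseline μ₀ κ) (expExcitation α β) τ ε J m s ω) *
        ((if ((s.toNNReal : ℝ≥0) : ℝ) ≤ t then K m (s.toNNReal, ω) else 0) *
          ∫⁻ ω, g (X ω) ∂P) =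
      ∫⁻ s in Set.Icc 0 t, (∫⁻ ω, g (X ω) ∂P) *
        (rate T μ₀ κ α β τ ε J m s ω * K m (s.toNNReal, ω)) := by
    -- The real intensity agrees with `rate` only on paths with finitely many arrivals, hence almost
    -- surely.
    filter_upwards [hN.locally_finite] with ω hω
    rw [← lintegral_indicator measurableSet_Icc, ← lintegral_indicator measurableSet_Icc]
    congr 1
    ext s
    by_cases hs : s ∈ Set.Icc 0 t
    · have hs' : s ∈ Set.Icc (0 : ℝ) T := ⟨hs.1, hs.2.trans ht⟩
      rw [Set.indicator_of_mem hs, Set.indicator_of_mem hs',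
        ofReal_intensity hω hs'.2 (fun i => hN.size_pos i ω) hμ₀ hα, Real.coe_toNNReal _ hs.1,
        if_pos hs.2]
      ring
    · rw [Set.indicator_of_notMem hs]
      by_cases hs' : s ∈ Set.Icc (0 : ℝ) T
      · have : ¬ s ≤ t := fun h => hs ⟨hs'.1, h⟩
        rw [Set.indicator_of_mem hs', Real.coe_toNNReal _ hs'.1, if_neg this]
        simp
      · rw [Set.indicator_of_notMem hs']
  have hF : Measurable fun p : ℝ × Ω =>
      rate T μ₀ κ α β τ ε J m p.1 p.2 * K m (p.1.toNNReal, p.2) := (hr m).mul (hKs m)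
  exact (lintegral_congr_ae hind).trans (lintegral_const_mul_swap hF _ _)

end Compensator

end MarkedHawkes

/-! ### Grönwall's inequality and the moment identities. -/

namespace MarkedHawkes

variable {Ω : Type*}

/-- Grönwall's inequality for the lower Lebesgue integral. -/
lemma le_of_le_add_lintegral {u : ℝ → ℝ≥0∞} {T K : ℝ} (hK : 0 < K) {B C : ℝ≥0∞} (hB : B ≠ ⊤)
    (hu : ∀ t ∈ Set.Icc 0 T, u t ≤ B)
    (h : ∀ t ∈ Set.Icc 0 T, u t ≤ C + ENNReal.ofReal K * ∫⁻ s in Set.Icc 0 t, u s) :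
    ∀ t ∈ Set.Icc 0 T, u t ≤ 2 * C * ENNReal.ofReal (Real.exp (2 * K * t)) := by
  -- With the weight `e^{-2Kt}` the integral operator has norm at most `1/2`, so the weighted
  -- supremum satisfies `M ≤ C + M/2`.
  set M : ℝ≥0∞ := ⨆ t ∈ Set.Icc 0 T, ENNReal.ofReal (Real.exp (-(2 * K * t))) * u t with hM
  have hinv : ∀ t : ℝ, ENNReal.ofReal (Real.exp (2 * K * t)) *
      ENNReal.ofReal (Real.exp (-(2 * K * t))) = 1 := by
    intro t
    rw [← ENNReal.ofReal_mul (by positivity), ← Real.exp_add]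
    simp
  have hMB : M ≤ B := by
    refine iSup₂_le fun t ht => ?_
    calc ENNReal.ofReal (Real.exp (-(2 * K * t))) * u t ≤ 1 * B := by
          gcongr
          · rw [ENNReal.ofReal_le_one, Real.exp_le_one_iff]
            have := ht.1
            simp only [Left.neg_nonpos_iff]
            positivity
          · exact hu t ht
      _ = B := one_mul B
  have huM : ∀ t ∈ Set.Icc 0 T, u t ≤ ENNReal.ofReal (Real.exp (2 * K * t)) * M := by
    intro t ht
    calc u t = ENNReal.ofReal (Real.exp (2 * K * t)) *
          (ENNReal.ofReal (Real.exp (-(2 * K * t))) * u t) := by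
          rw [← mul_assoc, hinv, one_mul]
      _ ≤ _ := by
          gcongr
          exact le_iSup₂ (f := fun t _ => ENNReal.ofReal (Real.exp (-(2 * K * t))) * u t) t ht
  have hint : ∀ t : ℝ, 0 ≤ t → ∫⁻ s in Set.Icc 0 t, ENNReal.ofReal (Real.exp (2 * K * s)) ≤
      ENNReal.ofReal (Real.exp (2 * K * t) / (2 * K)) := by
    intro t ht
    rw [← ofReal_integral_eq_lintegral_ofReal]
    · refine ENNReal.ofReal_le_ofReal ?_
      rw [integral_Icc_eq_integral_Ioc, ← intervalIntegral.integral_of_le ht]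
      have hd : ∀ s ∈ Set.uIcc 0 t, HasDerivAt (fun s => Real.exp (2 * K * s) / (2 * K))
          (Real.exp (2 * K * s)) s := by
        intro s _
        have h1 : HasDerivAt (fun s : ℝ => 2 * K * s) (2 * K) s := by
          simpa using (hasDerivAt_id s).const_mul (2 * K)
        have h2 := h1.exp.div_const (2 * K)
        rwa [mul_div_cancel_right₀ _ (by positivity)] at h2
      rw [intervalIntegral.integral_eq_sub_of_hasDerivAt hd
        (Continuous.intervalIntegrable (by fun_prop) _ _)]
      have : 0 < Real.exp (2 * K * 0) / (2 * K) := by positivity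
      linarith
    · exact (Continuous.continuousOn (by fun_prop)).integrableOn_Icc
    · exact Filter.Eventually.of_forall fun s => (Real.exp_pos _).le
  have hM2 : M ≤ C + M / 2 := by
    refine iSup₂_le fun t ht => ?_
    calc ENNReal.ofReal (Real.exp (-(2 * K * t))) * u t
        ≤ ENNReal.ofReal (Real.exp (-(2 * K * t))) *
          (C + ENNReal.ofReal K * (ENNReal.ofReal (Real.exp (2 * K * t) / (2 * K)) * M)) := by
          gcongr
          refine (h t ht).trans ?_
          gcongr
          calc ∫⁻ s in Set.Icc 0 t, u s
              ≤ ∫⁻ s in Set.Icc 0 t, ENNReal.ofReal (Real.exp (2 * K * s)) * M :=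
                setLIntegral_mono' measurableSet_Icc fun s hs => huM s ⟨hs.1, hs.2.trans ht.2⟩
            _ = (∫⁻ s in Set.Icc 0 t, ENNReal.ofReal (Real.exp (2 * K * s))) * M :=
                lintegral_mul_const _ (by fun_prop)
            _ ≤ _ := by
                gcongr
                exact hint t ht.1
      _ = ENNReal.ofReal (Real.exp (-(2 * K * t))) * C +
          ENNReal.ofReal (Real.exp (-(2 * K * t)) * (K * (Real.exp (2 * K * t) / (2 * K)))) *
            M := by
          rw [ENNReal.ofReal_mul (by positivity), ENNReal.ofReal_mul (by positivity)]
          ring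
      _ ≤ 1 * C + ENNReal.ofReal (1 / 2) * M := by
          gcongr
          · rw [ENNReal.ofReal_le_one, Real.exp_le_one_iff]
            have := ht.1
            simp only [Left.neg_nonpos_iff]
            positivity
          · rw [Real.exp_neg]
            field_simp
            exact le_rfl
      _ = C + M / 2 := by
          rw [one_mul, ENNReal.div_eq_inv_mul]
          congr 2
          rw [one_div, ENNReal.ofReal_inv_of_pos two_pos]
          simp
  -- The finite a priori bound `B` serves only here, to allow cancelling `M/2`; it does not enter
  -- the final estimate.
  have hMtop : M ≠ ⊤ := ne_top_of_le_ne_top hB hMB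
  have hM3 : M ≤ 2 * C := by
    have h2 : M / 2 + M / 2 ≤ C + M / 2 := by rwa [ENNReal.add_halves]
    have h3 : M / 2 ≤ C := by
      refine (ENNReal.add_le_add_iff_right ?_).1 h2
      exact ENNReal.div_ne_top hMtop (by simp)
    rw [ENNReal.div_le_iff (by simp) (by simp)] at h3
    rwa [mul_comm]
  intro t ht
  calc u t ≤ _ := huM t ht
    _ ≤ ENNReal.ofReal (Real.exp (2 * K * t)) * (2 * C) := by gcongr
    _ = _ := mul_comm _ _

section Moments

variable [mΩ : MeasurableSpace Ω] {P : Measure Ω} {𝓕 : Filtration ℝ≥0 mΩ} {T : ℝ≥0}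
  {μ₀ κ α β : ℝ} {X : Ω → ℝ} {τ : ℕ → Ω → ℝ≥0} {ε : ℕ → Ω → Fin 2} {J : ℕ → Ω → ℝ}

/-- Each path has countably many arrival times, so by Fubini almost every `s` is almost surely not
one of them. Left limits can therefore be dropped under time integrals. -/
lemma IsMarkedHawkes.ae_ae_marksLeft_eq [SFinite P] {μ : ℝ → ℝ} {φ : ℝ → Matrix (Fin 2) (Fin 2) ℝ}
    (hN : IsMarkedHawkes P 𝓕 T μ φ X τ ε J) :
    ∀ᵐ s : ℝ, ∀ᵐ ω ∂P, ∀ a, marksLeft τ ε J a s ω = marks τ ε J a s ω := by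
  have h1 : ∀ i, ∀ᵐ s : ℝ, ∀ᵐ ω ∂P, (τ i ω : ℝ) ≠ s := by
    intro i
    have hm : MeasurableSet {p : ℝ × Ω | (τ i p.2 : ℝ) ≠ p.1} :=
      (measurableSet_eq_fun (measurable_subtype_coe.comp
        ((hN.measurable_arrival i).comp measurable_snd)) measurable_fst).compl
    rw [Measure.ae_ae_comm hm]
    refine Filter.Eventually.of_forall fun ω => ?_
    filter_upwards [(Set.countable_singleton ((τ i ω : ℝ≥0) : ℝ)).ae_notMem volume] with s hs
    exact fun h => hs h.symm
  filter_upwards [ae_all_iff.2 h1] with s hs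
  filter_upwards [ae_all_iff.2 hs] with ω hω a
  refine tsum_congr fun i => ?_
  simp only [lt_iff_le_and_ne, hω i, ne_eq, not_false_eq_true, and_true]

lemma IsMarkedHawkes.measurable_marks_apply {μ : ℝ → ℝ} {φ : ℝ → Matrix (Fin 2) (Fin 2) ℝ}
    (hN : IsMarkedHawkes P 𝓕 T μ φ X τ ε J) {a : Fin 2 → ℝ → ℝ≥0∞} (ha : ∀ m, Measurable (a m))
    (t : ℝ) : Measurable fun ω => marks τ ε J a t ω :=
  (hN.measurable_marks ha).comp measurable_prodMk_left

lemma IsMarkedHawkes.measurable_rate_apply {μ : ℝ → ℝ} {φ : ℝ → Matrix (Fin 2) (Fin 2) ℝ}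
    (hN : IsMarkedHawkes P 𝓕 T μ φ X τ ε J) (m : Fin 2) (t : ℝ) :
    Measurable fun ω => rate T μ₀ κ α β τ ε J m t ω :=
  ((hN.measurable_marks_apply (measurable_expWeight β (1 - m)) t).const_mul _).const_add _

variable [SFinite P] (hμ₀ : 0 < μ₀) (hα : 0 < α) (hX : AEMeasurable X P)
    (hN : IsMarkedHawkes P 𝓕 T (expBaseline μ₀ κ) (expExcitation α β) X τ ε J)

include hμ₀ hα hX hN

/-- The mean of a sum over the arrivals. -/
theorem IsMarkedHawkes.lintegral_marks {a : Fin 2 → ℝ → ℝ≥0∞} (ha : ∀ m, Measurable (a m))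
    {t : ℝ} (ht : t ≤ T) :
    ∫⁻ ω, marks τ ε J a t ω ∂P = (∫⁻ ω, ENNReal.ofReal (X ω) ∂P) *
      ∑ m, ∫⁻ s in Set.Icc 0 t, a m s * ∫⁻ ω, rate T μ₀ κ α β τ ε J m s ω ∂P := by
  have h := hN.lintegral_tsum_arrivals hμ₀ hα hX (K := fun m p => a m p.1)
    (fun m => (ha m).comp (measurable_subtype_coe.comp measurable_fst_predictable))
    ENNReal.measurable_ofReal ht
  unfold marks
  rw [h]
  congr 1
  refine Finset.sum_congr rfl fun m _ => setLIntegral_congr_fun measurableSet_Icc fun s hs => ?_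
  simp only [Real.coe_toNNReal _ hs.1]
  rw [lintegral_mul_const _ (hN.measurable_rate_apply m s), mul_comm]

/-- The mean of the product of two sums over the arrivals. -/
theorem IsMarkedHawkes.lintegral_marks_mul_marks {a b : Fin 2 → ℝ → ℝ≥0∞}
    (ha : ∀ m, Measurable (a m)) (hb : ∀ m, Measurable (b m)) {t : ℝ} (ht : t ≤ T) :
    ∫⁻ ω, marks τ ε J a t ω * marks τ ε J b t ω ∂P =
      (∫⁻ ω, ENNReal.ofReal (X ω) ∂P) * (∑ m, ∫⁻ s in Set.Icc 0 t,
        (a m s * ∫⁻ ω, rate T μ₀ κ α β τ ε J m s ω * marks τ ε J b s ω ∂P +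
          b m s * ∫⁻ ω, rate T μ₀ κ α β τ ε J m s ω * marks τ ε J a s ω ∂P)) +
      (∫⁻ ω, ENNReal.ofReal (X ω) ^ 2 ∂P) * (∑ m, ∫⁻ s in Set.Icc 0 t,
        a m s * b m s * ∫⁻ ω, rate T μ₀ κ α β τ ε J m s ω ∂P) := by
  have hcoe : Measurable[𝓕.predictable] fun p : ℝ≥0 × Ω => (p.1 : ℝ) :=
    measurable_subtype_coe.comp measurable_fst_predictable
  have hL : ∀ {c : Fin 2 → ℝ → ℝ≥0∞}, (∀ m, Measurable (c m)) →
      Measurable[𝓕.predictable] fun p : ℝ≥0 × Ω => marksLeft τ ε J c p.1 p.2 := fun hc =>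
    measurable_predictable_marksLeft hN.isStoppingTime hN.measurable_type hN.measurable_size hc
  have h1 := hN.lintegral_tsum_arrivals hμ₀ hα hX
    (K := fun m p => a m p.1 * marksLeft τ ε J b p.1 p.2 + b m p.1 * marksLeft τ ε J a p.1 p.2)
    (fun m => (((ha m).comp hcoe).mul (hL hb)).add (((hb m).comp hcoe).mul (hL ha)))
    ENNReal.measurable_ofReal ht
  have h2 := hN.lintegral_tsum_arrivals hμ₀ hα hX (K := fun m p => a m p.1 * b m p.1)
    (fun m => ((ha m).comp hcoe).mul ((hb m).comp hcoe))
    (ENNReal.measurable_ofReal.pow_const 2) ht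
  have hsplit : ∀ ω, marks τ ε J a t ω * marks τ ε J b t ω =
      (∑' i, if (τ i ω : ℝ) ≤ t then (a (ε i ω) (τ i ω) * marksLeft τ ε J b (τ i ω) ω +
        b (ε i ω) (τ i ω) * marksLeft τ ε J a (τ i ω) ω) * ENNReal.ofReal (J i ω) else 0) +
      ∑' i, if (τ i ω : ℝ) ≤ t then
        a (ε i ω) (τ i ω) * b (ε i ω) (τ i ω) * ENNReal.ofReal (J i ω) ^ 2 else 0 := by
    intro ω
    rw [marks_mul_marks (hN.arrival_strictMono ω), ← ENNReal.tsum_add]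
    refine tsum_congr fun i => ?_
    split_ifs <;> simp
  simp_rw [hsplit]
  rw [lintegral_add_right, h1, h2]
  · congr 2
    · refine Finset.sum_congr rfl fun m _ => ?_
      refine lintegral_congr_ae ?_
      filter_upwards [ae_restrict_mem measurableSet_Icc,
        ae_restrict_of_ae hN.ae_ae_marksLeft_eq] with s hs hsm
      simp only [Real.coe_toNNReal _ hs.1]
      have hr := hN.measurable_rate_apply (μ₀ := μ₀) (κ := κ) (α := α) (β := β) m s
      have hma := hN.measurable_marks_apply ha s
      have hmb := hN.measurable_marks_apply hb s
      have hra : Measurable fun ω => rate T μ₀ κ α β τ ε J m s ω * marks τ ε J a s ω := hr.mul hma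
      have hrb : Measurable fun ω => rate T μ₀ κ α β τ ε J m s ω * marks τ ε J b s ω := hr.mul hmb
      rw [← lintegral_const_mul _ hrb, ← lintegral_const_mul _ hra,
        ← lintegral_add_left (hrb.const_mul _)]
      refine lintegral_congr_ae ?_
      filter_upwards [hsm] with ω hω
      rw [hω, hω]
      ring
    · refine Finset.sum_congr rfl fun m _ =>
        setLIntegral_congr_fun measurableSet_Icc fun s hs => ?_
      simp only [Real.coe_toNNReal _ hs.1]
      rw [lintegral_mul_const _ (hN.measurable_rate_apply m s), mul_comm]
  · refine Measurable.tsum fun i => ?_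
    have hτm := hN.measurable_arrival i
    have hεm := hN.measurable_kind i
    refine Measurable.ite (measurableSet_le (measurable_subtype_coe.comp hτm) measurable_const)
      (((measurable_apply_fin ha hεm hτm).mul (measurable_apply_fin hb hεm hτm)).mul
        ((ENNReal.measurable_ofReal.comp (hN.measurable_jump i)).pow_const 2)) measurable_const

end Moments

end MarkedHawkes

/-! ### Finite second moments by stopping at an arrival. -/

namespace MarkedHawkes

variable {Ω : Type*}

section

variable {τ : ℕ → Ω → ℝ≥0} {ε : ℕ → Ω → Fin 2} {J : ℕ → Ω → ℝ} {T : ℝ≥0} {μ₀ κ α β : ℝ}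

lemma marksLeft_le_marks (a : Fin 2 → ℝ → ℝ≥0∞) (t : ℝ) (ω : Ω) :
    marksLeft τ ε J a t ω ≤ marks τ ε J a t ω := by
  refine ENNReal.tsum_le_tsum fun i => ?_
  by_cases h : (τ i ω : ℝ) < t
  · simp [h, h.le]
  · simp [h]

lemma expWeight_le {b t : ℝ} (hb : 0 ≤ b) (m n : Fin 2) {s : ℝ} (hs : s ≤ t) :
    expWeight b m n s ≤ ENNReal.ofReal (Real.exp (b * t)) * 1 := by
  unfold expWeight
  split_ifs
  · rw [mul_one]
    gcongr
  · simp

lemma marks_expWeight_le {b t : ℝ} (hb : 0 ≤ b) (m : Fin 2) (ω : Ω) :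
    marks τ ε J (expWeight b m) t ω ≤
      ENNReal.ofReal (Real.exp (b * t)) * marks τ ε J (fun _ _ => 1) t ω := by
  rw [← marks_mul_const]
  exact marks_le_marks (fun n s hs => expWeight_le hb m n hs.2) ω

/-- Linear growth of the intensity in the accumulated sizes is what closes the Grönwall estimate:
`e^{βs} ≤ e^{βt}` absorbs the decay factor. -/
lemma rate_le (hμ₀ : 0 < μ₀) (hκ : 0 < κ) (hα : 0 < α) (hβ : 0 < β) {t : ℝ} (ht : t ≤ T)
    (m : Fin 2) (ω : Ω) :
    rate T μ₀ κ α β τ ε J m t ω ≤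
      ENNReal.ofReal (μ₀ * Real.exp κ + α) * (1 + marks τ ε J (fun _ _ => 1) t ω) := by
  have h1 : μ₀ * Real.exp (κ * (t / T)) ≤ μ₀ * Real.exp κ := by
    gcongr
    have : t / T ≤ 1 := div_le_one_of_le₀ ht T.2
    nlinarith
  have h2 : ENNReal.ofReal (α * Real.exp (-β * t)) * marks τ ε J (expWeight β (1 - m)) t ω ≤
      ENNReal.ofReal α * marks τ ε J (fun _ _ => 1) t ω := by
    calc _ ≤ ENNReal.ofReal (α * Real.exp (-β * t)) *
          (ENNReal.ofReal (Real.exp (β * t)) * marks τ ε J (fun _ _ => 1) t ω) := by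
          gcongr
          exact marks_expWeight_le hβ.le _ ω
      _ = _ := by
          rw [← mul_assoc, ← ENNReal.ofReal_mul (by positivity), mul_assoc α, ← Real.exp_add]
          simp
  unfold rate
  rw [ENNReal.ofReal_add (by positivity) hα.le, add_mul, mul_add, mul_add, mul_one]
  calc _ ≤ ENNReal.ofReal (μ₀ * Real.exp κ) +
        ENNReal.ofReal α * marks τ ε J (fun _ _ => 1) t ω := by gcongr
    _ ≤ _ := by
      gcongr
      · exact le_self_add
      · exact le_add_self

end

section Moments

variable [mΩ : MeasurableSpace Ω] {P : Measure Ω} {𝓕 : Filtration ℝ≥0 mΩ} {T : ℝ≥0}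
  {μ₀ κ α β : ℝ} {X : Ω → ℝ} {τ : ℕ → Ω → ℝ≥0} {ε : ℕ → Ω → Fin 2} {J : ℕ → Ω → ℝ}

omit mΩ in
/-- A bound for the sum of the sizes up to `t`, if `t` is not after arrival `n`. -/
lemma marks_one_le_sum {ω : Ω} {t : ℝ} {n : ℕ} (hτ : StrictMono fun i => τ i ω)
    (ht : t ≤ τ n ω) :
    marks τ ε J (fun _ _ => 1) t ω ≤ ∑ i ∈ Finset.range (n + 1), ENNReal.ofReal (J i ω) := by
  unfold marks
  -- Index `n` is included because `t` may equal `τ n ω`.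
  rw [tsum_eq_sum (s := Finset.range (n + 1))]
  · refine Finset.sum_le_sum fun i _ => ?_
    split_ifs <;> simp
  · intro i hi
    have hni : n < i := by
      rw [Finset.mem_range] at hi
      omega
    have h : τ n ω < τ i ω := hτ hni
    rw [if_neg]
    exact not_le.2 (ht.trans_lt (NNReal.coe_lt_coe.2 h))

variable [IsProbabilityMeasure P]

/-- This supplies the finite a priori bound in Grönwall's inequality. It depends on `n`, which is
harmless. -/
lemma IsMarkedHawkes.lintegral_sum_sq_lt_top {μ : ℝ → ℝ} {φ : ℝ → Matrix (Fin 2) (Fin 2) ℝ}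
    (hN : IsMarkedHawkes P 𝓕 T μ φ X τ ε J) (hX : MemLp X 2 P) (n : ℕ) :
    ∫⁻ ω, (1 + ∑ i ∈ Finset.range n, ENNReal.ofReal (J i ω)) ^ 2 ∂P < ⊤ := by
  have h0 : MemLp (fun ω => ∑ i ∈ Finset.range n, J i ω) 2 P :=
    memLp_finsetSum _ fun i _ => (hN.size_identDistrib i).memLp_iff.2 hX
  have h1 : MemLp (fun ω => 1 + ∑ i ∈ Finset.range n, J i ω) 2 P :=
    (memLp_const (1 : ℝ)).add h0
  have h2 := h1.integrable_sq.lintegral_lt_top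
  convert h2 using 1
  refine lintegral_congr fun ω => ?_
  have hnn : 0 ≤ ∑ i ∈ Finset.range n, J i ω := Finset.sum_nonneg fun i _ => (hN.size_pos i ω).le
  rw [ENNReal.ofReal_pow (by positivity), ENNReal.ofReal_add zero_le_one hnn,
    ENNReal.ofReal_sum_of_nonneg fun i _ => (hN.size_pos i ω).le, ENNReal.ofReal_one]

lemma lintegral_ofReal_ne_top (hX : MemLp X 2 P) : ∫⁻ ω, ENNReal.ofReal (X ω) ∂P ≠ ⊤ :=
  (hX.integrable one_le_two).lintegral_lt_top.ne

omit [IsProbabilityMeasure P] in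
lemma lintegral_ofReal_sq_ne_top (hX : MemLp X 2 P) : ∫⁻ ω, ENNReal.ofReal (X ω) ^ 2 ∂P ≠ ⊤ := by
  refine ne_top_of_le_ne_top hX.integrable_sq.lintegral_lt_top.ne (lintegral_mono fun ω => ?_)
  rcases le_total 0 (X ω) with h | h
  · rw [ENNReal.ofReal_pow h]
  · simp [ENNReal.ofReal_of_nonpos h]

omit mΩ in
/-- Pathwise bound for the squared sum of the sizes, stopped at an arrival. -/
lemma indicator_one_add_marks_sq_le {ω : Ω} (hτ : StrictMono fun i => τ i ω) (t : ℝ) (n : ℕ) :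
    (if t ≤ τ n ω then (1 + marks τ ε J (fun _ _ => 1) t ω) ^ 2 else 0) ≤
      1 + ((∑' i, if (τ i ω : ℝ) ≤ t then (if τ i ω ≤ τ n ω then
          2 + 2 * marksLeft τ ε J (fun _ _ => 1) (τ i ω) ω else 0) * ENNReal.ofReal (J i ω) else 0) +
        ∑' i, if (τ i ω : ℝ) ≤ t then (if τ i ω ≤ τ n ω then 1 else 0) *
          ENNReal.ofReal (J i ω) ^ 2 else 0) := by
  split_ifs with ht
  -- With `L` the accumulated sizes, `(1 + L)² = 1 + 2L + L²`; an arrival thus adds `(2 + 2L₋) J +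
  -- J²`, with `L₋` the value just before it.
  · have h1 : (1 + marks τ ε J (fun _ _ => 1) t ω) ^ 2 = 1 + (2 * marks τ ε J (fun _ _ => 1) t ω +
        marks τ ε J (fun _ _ => 1) t ω * marks τ ε J (fun _ _ => 1) t ω) := by ring
    rw [h1, marks_mul_marks hτ, marks, ← ENNReal.tsum_mul_left, ← ENNReal.tsum_add,
      ← ENNReal.tsum_add]
    refine add_le_add_right (ENNReal.tsum_le_tsum fun i => ?_) 1
    by_cases hi : (τ i ω : ℝ) ≤ t
    · have hin : τ i ω ≤ τ n ω := NNReal.coe_le_coe.1 (hi.trans ht)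
      simp only [if_pos hi, if_pos hin]
      refine le_of_eq ?_
      ring
    · simp [hi]
  · exact zero_le

variable (hμ₀ : 0 < μ₀) (hκ : 0 < κ) (hα : 0 < α) (hβ : 0 < β) (hX : MemLp X 2 P)
    (hN : IsMarkedHawkes P 𝓕 T (expBaseline μ₀ κ) (expExcitation α β) X τ ε J)

include hμ₀ hκ hα hβ hX hN

/-- The integral inequality for the second moment of the accumulated sizes, stopped at an
arrival. -/
lemma IsMarkedHawkes.lintegral_stopped_sq_le (n : ℕ) {t : ℝ} (ht : t ≤ T) :
    ∫⁻ ω, (if t ≤ τ n ω then (1 + marks τ ε J (fun _ _ => 1) t ω) ^ 2 else 0) ∂P ≤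
      1 + (4 * (∫⁻ ω, ENNReal.ofReal (X ω) ∂P) + 2 * ∫⁻ ω, ENNReal.ofReal (X ω) ^ 2 ∂P) *
          ENNReal.ofReal (μ₀ * Real.exp κ + α) *
        ∫⁻ s in Set.Icc 0 t, ∫⁻ ω,
          (if s ≤ τ n ω then (1 + marks τ ε J (fun _ _ => 1) s ω) ^ 2 else 0) ∂P := by
  have hpred := measurableSet_predictable_le (hN.isStoppingTime n)
  have hL : Measurable[𝓕.predictable]
      fun p : ℝ≥0 × Ω => marksLeft τ ε J (fun _ _ => 1) p.1 p.2 :=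
    measurable_predictable_marksLeft hN.isStoppingTime hN.measurable_type hN.measurable_size
      fun _ => measurable_const
  have h1 := hN.lintegral_tsum_arrivals hμ₀ hα hX.aestronglyMeasurable.aemeasurable
    (K := fun _ p => if p.1 ≤ τ n p.2 then 2 + 2 * marksLeft τ ε J (fun _ _ => 1) p.1 p.2 else 0)
    (fun _ => by
      let _ : MeasurableSpace (ℝ≥0 × Ω) := 𝓕.predictable
      exact Measurable.ite hpred ((hL.const_mul 2).const_add 2) measurable_const)
    ENNReal.measurable_ofReal ht
  have h2 := hN.lintegral_tsum_arrivals hμ₀ hα hX.aestronglyMeasurable.aemeasurable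
    (K := fun _ p => if p.1 ≤ τ n p.2 then 1 else 0)
    (fun _ => by
      let _ : MeasurableSpace (ℝ≥0 × Ω) := 𝓕.predictable
      exact Measurable.ite hpred measurable_const measurable_const)
    (ENNReal.measurable_ofReal.pow_const 2) ht
  set R := ENNReal.ofReal (μ₀ * Real.exp κ + α) with hR
  set L := fun (s : ℝ) ω => marks τ ε J (fun _ _ => 1) s ω with hLdef
  have hRtop : R ≠ ⊤ := ENNReal.ofReal_ne_top
  -- Here `R (1 + L) (2 + 2L) = 2R (1 + L)²`; summing over both types gives the factor `4` of the
  -- claim. In `hb2`, `1 ≤ 1 + L` gives the factor `2`.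
  have hb1 : ∀ m : Fin 2, ∫⁻ s in Set.Icc 0 t, ∫⁻ ω, rate T μ₀ κ α β τ ε J m s ω *
      (if s.toNNReal ≤ τ n ω then
        2 + 2 * marksLeft τ ε J (fun _ _ => 1) (s.toNNReal : ℝ≥0) ω else 0) ∂P ≤
      2 * R * ∫⁻ s in Set.Icc 0 t, ∫⁻ ω, (if s ≤ τ n ω then (1 + L s ω) ^ 2 else 0) ∂P := by
    intro m
    rw [← lintegral_const_mul' _ _ (by finiteness)]
    refine setLIntegral_mono' measurableSet_Icc fun s hs => ?_
    rw [← lintegral_const_mul' _ _ (by finiteness)]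
    refine lintegral_mono fun ω => ?_
    have hiff : s.toNNReal ≤ τ n ω ↔ s ≤ τ n ω := Real.toNNReal_le_iff_le_coe
    simp only [hiff, Real.coe_toNNReal _ hs.1]
    split_ifs
    · calc _ ≤ R * (1 + L s ω) * (2 + 2 * L s ω) := by
            gcongr
            · exact rate_le hμ₀ hκ hα hβ (hs.2.trans ht) m ω
            · exact marksLeft_le_marks _ _ _
        _ = _ := by ring
    · simp
  have hb2 : ∀ m : Fin 2, ∫⁻ s in Set.Icc 0 t, ∫⁻ ω, rate T μ₀ κ α β τ ε J m s ω *
      (if s.toNNReal ≤ τ n ω then 1 else 0) ∂P ≤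
      R * ∫⁻ s in Set.Icc 0 t, ∫⁻ ω, (if s ≤ τ n ω then (1 + L s ω) ^ 2 else 0) ∂P := by
    intro m
    rw [← lintegral_const_mul' _ _ (by finiteness)]
    refine setLIntegral_mono' measurableSet_Icc fun s hs => ?_
    rw [← lintegral_const_mul' _ _ (by finiteness)]
    refine lintegral_mono fun ω => ?_
    have hiff : s.toNNReal ≤ τ n ω ↔ s ≤ τ n ω := Real.toNNReal_le_iff_le_coe
    simp only [hiff]
    split_ifs
    · calc _ ≤ R * (1 + L s ω) * 1 := by
            gcongr
            exact rate_le hμ₀ hκ hα hβ (hs.2.trans ht) m ω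
        _ ≤ R * (1 + L s ω) * (1 + L s ω) := by
            gcongr
            exact le_self_add
        _ = _ := by ring
    · simp
  calc _ ≤ ∫⁻ ω, (1 + ((∑' i, if (τ i ω : ℝ) ≤ t then (if τ i ω ≤ τ n ω then
          2 + 2 * marksLeft τ ε J (fun _ _ => 1) (τ i ω) ω else 0) * ENNReal.ofReal (J i ω) else 0) +
        ∑' i, if (τ i ω : ℝ) ≤ t then (if τ i ω ≤ τ n ω then 1 else 0) *
          ENNReal.ofReal (J i ω) ^ 2 else 0)) ∂P :=
        lintegral_mono fun ω => indicator_one_add_marks_sq_le (hN.arrival_strictMono ω) t n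
    _ = _ := by
        rw [lintegral_add_left measurable_const, lintegral_add_right]
        · rw [h1, h2]
          simp only [lintegral_const, measure_univ, mul_one]
        · refine Measurable.tsum fun i => ?_
          have hτ := fun i => hN.measurable_arrival i
          exact Measurable.ite (measurableSet_le (measurable_subtype_coe.comp (hτ i))
            measurable_const) ((Measurable.ite (measurableSet_le (hτ i) (hτ n)) measurable_const
              measurable_const).mul
            ((ENNReal.measurable_ofReal.comp (hN.measurable_jump i)).pow_const 2)) measurable_const
    _ ≤ 1 + ((∫⁻ ω, ENNReal.ofReal (X ω) ∂P) * ∑ _m : Fin 2,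
          2 * R * (∫⁻ s in Set.Icc 0 t, ∫⁻ ω, (if s ≤ τ n ω then (1 + L s ω) ^ 2 else 0) ∂P) +
        (∫⁻ ω, ENNReal.ofReal (X ω) ^ 2 ∂P) * ∑ _m : Fin 2,
          R * ∫⁻ s in Set.Icc 0 t, ∫⁻ ω, (if s ≤ τ n ω then (1 + L s ω) ^ 2 else 0) ∂P) :=
        add_le_add_right (add_le_add (mul_le_mul_right (Finset.sum_le_sum fun m _ => hb1 m) _)
          (mul_le_mul_right (Finset.sum_le_sum fun m _ => hb2 m) _)) 1
    _ = _ := by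
        rw [Fin.sum_univ_two, Fin.sum_univ_two]
        ring

/-- The accumulated sizes have bounded second moments on `[0, T]`. -/
theorem IsMarkedHawkes.exists_lintegral_sq_le :
    ∃ C : ℝ≥0∞, C ≠ ⊤ ∧ ∀ t ∈ Set.Icc (0 : ℝ) T,
      ∫⁻ ω, (1 + marks τ ε J (fun _ _ => 1) t ω) ^ 2 ∂P ≤ C := by
  set K₀ : ℝ≥0∞ := (4 * (∫⁻ ω, ENNReal.ofReal (X ω) ∂P) + 2 * ∫⁻ ω, ENNReal.ofReal (X ω) ^ 2 ∂P) *
    ENNReal.ofReal (μ₀ * Real.exp κ + α) with hK₀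
  have hK₀top : K₀ ≠ ⊤ := by
    have h1 := lintegral_ofReal_ne_top hX
    have h2 := lintegral_ofReal_sq_ne_top hX
    finiteness
  -- The added `1` only makes the Grönwall constant positive.
  set K : ℝ := K₀.toReal + 1 with hK
  have hKpos : 0 < K := by positivity
  have hK₀K : K₀ ≤ ENNReal.ofReal K := by
    rw [← ENNReal.ofReal_toReal hK₀top]
    exact ENNReal.ofReal_le_ofReal (by linarith)
  refine ⟨2 * 1 * ENNReal.ofReal (Real.exp (2 * K * T)), by finiteness, fun t ht => ?_⟩
  have hLm : Measurable fun ω => marks τ ε J (fun _ _ => 1) t ω :=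
    hN.measurable_marks_apply (fun _ => measurable_const) t
  have hbound : ∀ n, ∫⁻ ω, (if t ≤ τ n ω then (1 + marks τ ε J (fun _ _ => 1) t ω) ^ 2 else 0) ∂P ≤
      2 * 1 * ENNReal.ofReal (Real.exp (2 * K * T)) := by
    intro n
    refine (le_of_le_add_lintegral (u := fun t => ∫⁻ ω, (if t ≤ τ n ω then
      (1 + marks τ ε J (fun _ _ => 1) t ω) ^ 2 else 0) ∂P) (C := 1) hKpos
      (hN.lintegral_sum_sq_lt_top hX (n + 1)).ne (fun s hs => lintegral_mono fun ω => ?_)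
      (fun s hs => ?_) t ht).trans ?_
    · dsimp only
      split_ifs with h
      · gcongr
        exact marks_one_le_sum (hN.arrival_strictMono ω) h
      · exact zero_le
    · refine (hN.lintegral_stopped_sq_le hμ₀ hκ hα hβ hX n hs.2).trans ?_
      gcongr
    · gcongr
      exact ht.2
  -- Almost surely some arrival lies beyond `T`, so the stopping is eventually inactive and monotone
  -- convergence removes it from the uniform bound.
  have hsup : ∀ᵐ ω ∂P, (1 + marks τ ε J (fun _ _ => 1) t ω) ^ 2 =
      ⨆ n, if t ≤ τ n ω then (1 + marks τ ε J (fun _ _ => 1) t ω) ^ 2 else 0 := by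
    filter_upwards [hN.locally_finite] with ω hω
    obtain ⟨n, hn⟩ : ∃ n, T < τ n ω := by
      by_contra! h
      exact Set.infinite_univ (hω.subset fun i _ => h i)
    refine le_antisymm ?_ (iSup_le fun n => ?_)
    · refine le_iSup_of_le n ?_
      rw [if_pos (ht.2.trans (NNReal.coe_le_coe.2 hn.le))]
    · split_ifs
      exacts [le_rfl, zero_le]
  rw [lintegral_congr_ae hsup, lintegral_iSup]
  · exact iSup_le hbound
  · intro n
    exact Measurable.ite (measurableSet_le measurable_const
      (measurable_subtype_coe.comp (hN.measurable_arrival n))) ((hLm.const_add 1).pow_const 2)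
      measurable_const
  · intro n k hnk ω
    dsimp only
    by_cases h : t ≤ τ n ω
    · have h' : t ≤ τ k ω :=
        h.trans (NNReal.coe_le_coe.2 ((hN.arrival_strictMono ω).monotone hnk))
      rw [if_pos h, if_pos h']
    · rw [if_neg h]
      exact zero_le

end Moments

end MarkedHawkes

/-! ### Integral equations for real first and second moments. -/

namespace MarkedHawkes

variable {Ω : Type*} [mΩ : MeasurableSpace Ω]

/-- The mean of the sum of `e^{b s} J_s` over the arrivals of type `m` up to time `t`. -/
noncomputable def mean (P : Measure Ω) (τ : ℕ → Ω → ℝ≥0) (ε : ℕ → Ω → Fin 2) (J : ℕ → Ω → ℝ)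
    (b : ℝ) (m : Fin 2) (t : ℝ) : ℝ :=
  (∫⁻ ω, marks τ ε J (expWeight b m) t ω ∂P).toReal

/-- The mixed second moment of the sums of `e^{b s} J_s` and `e^{b' s} J_s` over the arrivals of
types `m` and `n` up to time `t`. -/
noncomputable def cross (P : Measure Ω) (τ : ℕ → Ω → ℝ≥0) (ε : ℕ → Ω → Fin 2) (J : ℕ → Ω → ℝ)
    (b : ℝ) (m : Fin 2) (b' : ℝ) (n : Fin 2) (t : ℝ) : ℝ :=
  (∫⁻ ω, marks τ ε J (expWeight b m) t ω * marks τ ε J (expWeight b' n) t ω ∂P).toReal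

section Moments

variable {P : Measure Ω} {𝓕 : Filtration ℝ≥0 mΩ} {T : ℝ≥0}
  {μ₀ κ α β : ℝ} {X : Ω → ℝ} {τ : ℕ → Ω → ℝ≥0} {ε : ℕ → Ω → Fin 2} {J : ℕ → Ω → ℝ}

lemma toReal_mul_add_mul {a c d : ℝ} (ha : 0 ≤ a) (hc : 0 ≤ c) (hd : 0 ≤ d) {x y : ℝ≥0∞}
    (hx : x ≠ ⊤) (hy : y ≠ ⊤) :
    (ENNReal.ofReal a * (ENNReal.ofReal c * x + ENNReal.ofReal d * y)).toReal =
      a * (c * x.toReal + d * y.toReal) := by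
  rw [ENNReal.toReal_mul, ENNReal.toReal_add (by finiteness) (by finiteness), ENNReal.toReal_mul,
    ENNReal.toReal_mul, ENNReal.toReal_ofReal ha, ENNReal.toReal_ofReal hc,
    ENNReal.toReal_ofReal hd]

lemma mul_add_mul_ne_top (a c d : ℝ) {x y : ℝ≥0∞} (hx : x ≠ ⊤) (hy : y ≠ ⊤) :
    ENNReal.ofReal a * (ENNReal.ofReal c * x + ENNReal.ofReal d * y) ≠ ⊤ := by
  finiteness

lemma sum_expWeight_mul (b : ℝ) (m : Fin 2) (s : ℝ) (x : Fin 2 → ℝ≥0∞) :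
    ∑ k, expWeight b m k s * x k = ENNReal.ofReal (Real.exp (b * s)) * x m := by
  simp [expWeight]

section Measurability

variable [SFinite P] {μ : ℝ → ℝ} {φ : ℝ → Matrix (Fin 2) (Fin 2) ℝ}
  (hN : IsMarkedHawkes P 𝓕 T μ φ X τ ε J)

include hN

lemma IsMarkedHawkes.measurable_lintegral_marks (b : ℝ) (m : Fin 2) :
    Measurable fun t => ∫⁻ ω, marks τ ε J (expWeight b m) t ω ∂P :=
  (hN.measurable_marks (measurable_expWeight b m)).lintegral_prod_right'

lemma IsMarkedHawkes.measurable_lintegral_marks_mul (b : ℝ) (m : Fin 2) (b' : ℝ) (n : Fin 2) :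
    Measurable fun t =>
      ∫⁻ ω, marks τ ε J (expWeight b m) t ω * marks τ ε J (expWeight b' n) t ω ∂P :=
  ((hN.measurable_marks (measurable_expWeight b m)).mul
    (hN.measurable_marks (measurable_expWeight b' n))).lintegral_prod_right'

lemma IsMarkedHawkes.measurable_mean (b : ℝ) (m : Fin 2) : Measurable (mean P τ ε J b m) :=
  (hN.measurable_lintegral_marks b m).ennreal_toReal

lemma IsMarkedHawkes.measurable_cross (b : ℝ) (m : Fin 2) (b' : ℝ) (n : Fin 2) :
    Measurable (cross P τ ε J b m b' n) :=
  (hN.measurable_lintegral_marks_mul b m b' n).ennreal_toReal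

end Measurability

variable [IsProbabilityMeasure P]

lemma lintegral_rate (m : Fin 2) (s : ℝ) :
    ∫⁻ ω, rate T μ₀ κ α β τ ε J m s ω ∂P = ENNReal.ofReal (μ₀ * Real.exp (κ * (s / T))) +
      ENNReal.ofReal (α * Real.exp (-β * s)) *
        ∫⁻ ω, marks τ ε J (expWeight β (1 - m)) s ω ∂P := by
  unfold rate
  rw [lintegral_add_left measurable_const, lintegral_const_mul' _ _ ENNReal.ofReal_ne_top]
  simp

omit [IsProbabilityMeasure P] in
lemma IsMarkedHawkes.lintegral_rate_mul {μ : ℝ → ℝ} {φ : ℝ → Matrix (Fin 2) (Fin 2) ℝ}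
    (hN : IsMarkedHawkes P 𝓕 T μ φ X τ ε J) (m : Fin 2) (b : ℝ) (n : Fin 2) (s : ℝ) :
    ∫⁻ ω, rate T μ₀ κ α β τ ε J m s ω * marks τ ε J (expWeight b n) s ω ∂P =
      ENNReal.ofReal (μ₀ * Real.exp (κ * (s / T))) *
        ∫⁻ ω, marks τ ε J (expWeight b n) s ω ∂P +
      ENNReal.ofReal (α * Real.exp (-β * s)) *
        ∫⁻ ω, marks τ ε J (expWeight β (1 - m)) s ω * marks τ ε J (expWeight b n) s ω ∂P := by
  unfold rate
  have hm := hN.measurable_marks_apply (measurable_expWeight b n) s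
  simp_rw [add_mul, mul_assoc]
  rw [lintegral_add_left (hm.const_mul _), lintegral_const_mul' _ _ ENNReal.ofReal_ne_top,
    lintegral_const_mul' _ _ ENNReal.ofReal_ne_top]

omit [IsProbabilityMeasure P] in
lemma IsMarkedHawkes.ae_pos {μ : ℝ → ℝ} {φ : ℝ → Matrix (Fin 2) (Fin 2) ℝ}
    (hN : IsMarkedHawkes P 𝓕 T μ φ X τ ε J) : ∀ᵐ ω ∂P, 0 < X ω :=
  (hN.size_identDistrib 0).ae_snd measurableSet_Ioi
    (Filter.Eventually.of_forall fun ω => hN.size_pos 0 ω)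

omit [IsProbabilityMeasure P] in
lemma IsMarkedHawkes.toReal_lintegral_ofReal {μ : ℝ → ℝ} {φ : ℝ → Matrix (Fin 2) (Fin 2) ℝ}
    (hN : IsMarkedHawkes P 𝓕 T μ φ X τ ε J) (hX : MemLp X 2 P) :
    (∫⁻ ω, ENNReal.ofReal (X ω) ∂P).toReal = ∫ ω, X ω ∂P :=
  (integral_eq_lintegral_of_nonneg_ae (hN.ae_pos.mono fun _ h => h.le)
    hX.aestronglyMeasurable).symm

omit [IsProbabilityMeasure P] in
lemma IsMarkedHawkes.toReal_lintegral_ofReal_sq {μ : ℝ → ℝ} {φ : ℝ → Matrix (Fin 2) (Fin 2) ℝ}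
    (hN : IsMarkedHawkes P 𝓕 T μ φ X τ ε J) (hX : MemLp X 2 P) :
    (∫⁻ ω, ENNReal.ofReal (X ω) ^ 2 ∂P).toReal = ∫ ω, X ω ^ 2 ∂P := by
  rw [integral_eq_lintegral_of_nonneg_ae (Filter.Eventually.of_forall fun ω => sq_nonneg (X ω))
    (hX.aestronglyMeasurable.pow 2)]
  congr 1
  refine lintegral_congr_ae ?_
  filter_upwards [hN.ae_pos] with ω h
  rw [ENNReal.ofReal_pow h.le]

variable (hμ₀ : 0 < μ₀) (hκ : 0 < κ) (hα : 0 < α) (hβ : 0 < β) (hX : MemLp X 2 P)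
    (hN : IsMarkedHawkes P 𝓕 T (expBaseline μ₀ κ) (expExcitation α β) X τ ε J)

include hμ₀ hκ hα hβ hX hN

/-- On `[0, T]` a weight with exponent `d ≥ 0` is at most `e^{dT}`, so every product is dominated by
a multiple of `(1 + L)²`, `L` being the accumulated sizes. -/
lemma IsMarkedHawkes.exists_lintegral_marks_mul_le {b b' : ℝ} (hb : 0 ≤ b) (hb' : 0 ≤ b')
    (m n : Fin 2) : ∃ C : ℝ≥0∞, C ≠ ⊤ ∧ ∀ t ∈ Set.Icc (0 : ℝ) T,
      ∫⁻ ω, marks τ ε J (expWeight b m) t ω * marks τ ε J (expWeight b' n) t ω ∂P ≤ C := by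
  obtain ⟨C, hC, h⟩ := hN.exists_lintegral_sq_le hμ₀ hκ hα hβ hX
  refine ⟨ENNReal.ofReal (Real.exp (b * T)) * ENNReal.ofReal (Real.exp (b' * T)) * C,
    by finiteness, fun t ht => ?_⟩
  calc _ ≤ ∫⁻ ω, ENNReal.ofReal (Real.exp (b * T)) * ENNReal.ofReal (Real.exp (b' * T)) *
        (1 + marks τ ε J (fun _ _ => 1) t ω) ^ 2 ∂P := by
        refine lintegral_mono fun ω => ?_
        have h1 : ∀ {d : ℝ}, 0 ≤ d → ∀ k, marks τ ε J (expWeight d k) t ω ≤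
            ENNReal.ofReal (Real.exp (d * T)) * (1 + marks τ ε J (fun _ _ => 1) t ω) := by
          intro d hd k
          refine (marks_expWeight_le hd k ω).trans ?_
          gcongr
          · exact ht.2
          · exact le_add_self
        calc _ ≤ _ := mul_le_mul' (h1 hb m) (h1 hb' n)
          _ = _ := by ring
    _ ≤ _ := by
        rw [lintegral_const_mul' _ _ (by finiteness)]
        gcongr
        exact h t ht

/-- First moments are controlled by second ones through `x ≤ 1 + x²`. -/
lemma IsMarkedHawkes.exists_lintegral_marks_le {b : ℝ} (hb : 0 ≤ b) (m : Fin 2) :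
    ∃ C : ℝ≥0∞, C ≠ ⊤ ∧ ∀ t ∈ Set.Icc (0 : ℝ) T,
      ∫⁻ ω, marks τ ε J (expWeight b m) t ω ∂P ≤ C := by
  obtain ⟨C, hC, h⟩ := hN.exists_lintegral_marks_mul_le hμ₀ hκ hα hβ hX hb hb m m
  refine ⟨1 + C, by finiteness, fun t ht => ?_⟩
  calc _ ≤ ∫⁻ ω, (1 + marks τ ε J (expWeight b m) t ω * marks τ ε J (expWeight b m) t ω) ∂P := by
        refine lintegral_mono fun ω => ?_
        rcases le_total (marks τ ε J (expWeight b m) t ω) 1 with h1 | h1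
        · exact h1.trans le_self_add
        · calc _ = marks τ ε J (expWeight b m) t ω * 1 := (mul_one _).symm
            _ ≤ marks τ ε J (expWeight b m) t ω * marks τ ε J (expWeight b m) t ω := by gcongr
            _ ≤ _ := le_add_self
    _ ≤ _ := by
        rw [lintegral_add_left measurable_const]
        simp only [lintegral_const, measure_univ, mul_one]
        gcongr
        exact h t ht

lemma IsMarkedHawkes.lintegral_marks_ne_top {b : ℝ} (hb : 0 ≤ b) (m : Fin 2) {t : ℝ}
    (ht : t ∈ Set.Icc (0 : ℝ) T) : ∫⁻ ω, marks τ ε J (expWeight b m) t ω ∂P ≠ ⊤ := by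
  obtain ⟨C, hC, h⟩ := hN.exists_lintegral_marks_le hμ₀ hκ hα hβ hX hb m
  exact ne_top_of_le_ne_top hC (h t ht)

lemma IsMarkedHawkes.lintegral_marks_mul_ne_top {b b' : ℝ} (hb : 0 ≤ b) (hb' : 0 ≤ b')
    (m n : Fin 2) {t : ℝ} (ht : t ∈ Set.Icc (0 : ℝ) T) :
    ∫⁻ ω, marks τ ε J (expWeight b m) t ω * marks τ ε J (expWeight b' n) t ω ∂P ≠ ⊤ := by
  obtain ⟨C, hC, h⟩ := hN.exists_lintegral_marks_mul_le hμ₀ hκ hα hβ hX hb hb' m n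
  exact ne_top_of_le_ne_top hC (h t ht)

lemma IsMarkedHawkes.exists_mean_le {b : ℝ} (hb : 0 ≤ b) (m : Fin 2) :
    ∃ C : ℝ, ∀ t ∈ Set.Icc (0 : ℝ) T, ‖mean P τ ε J b m t‖ ≤ C := by
  obtain ⟨C, hC, h⟩ := hN.exists_lintegral_marks_le hμ₀ hκ hα hβ hX hb m
  refine ⟨C.toReal, fun t ht => ?_⟩
  refine (Real.norm_of_nonneg ENNReal.toReal_nonneg).trans_le ?_
  exact ENNReal.toReal_mono hC (h t ht)

lemma IsMarkedHawkes.exists_cross_le {b b' : ℝ} (hb : 0 ≤ b) (hb' : 0 ≤ b') (m n : Fin 2) :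
    ∃ C : ℝ, ∀ t ∈ Set.Icc (0 : ℝ) T, ‖cross P τ ε J b m b' n t‖ ≤ C := by
  obtain ⟨C, hC, h⟩ := hN.exists_lintegral_marks_mul_le hμ₀ hκ hα hβ hX hb hb' m n
  refine ⟨C.toReal, fun t ht => ?_⟩
  refine (Real.norm_of_nonneg ENNReal.toReal_nonneg).trans_le ?_
  exact ENNReal.toReal_mono hC (h t ht)

/-- The integral equation for the means. -/
theorem IsMarkedHawkes.mean_eq {b : ℝ} (m : Fin 2) {t : ℝ} (ht : t ≤ T) :
    mean P τ ε J b m t = (∫ ω, X ω ∂P) * ∫ s in Set.Icc 0 t, Real.exp (b * s) *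
      (μ₀ * Real.exp (κ * (s / T)) + α * Real.exp (-β * s) * mean P τ ε J β (1 - m) s) := by
  have hm : ∀ k, Measurable fun s => expWeight b m k s *
      ∫⁻ ω, rate T μ₀ κ α β τ ε J k s ω ∂P := fun k =>
    (measurable_expWeight b m k).mul (hN.measurable_rate k).lintegral_prod_right'
  rw [mean, hN.lintegral_marks hμ₀ hα hX.aestronglyMeasurable.aemeasurable
    (measurable_expWeight b m) ht, ← lintegral_finsetSum _ fun k _ => hm k]
  simp_rw [sum_expWeight_mul, lintegral_rate]
  rw [ENNReal.toReal_mul, hN.toReal_lintegral_ofReal hX, ← integral_toReal]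
  · congr 1
    refine setIntegral_congr_fun measurableSet_Icc fun s hs => ?_
    have hs' : s ∈ Set.Icc (0 : ℝ) T := ⟨hs.1, hs.2.trans ht⟩
    have h1 := hN.lintegral_marks_ne_top hμ₀ hκ hα hβ hX hβ.le (1 - m) hs'
    simp only [mean]
    rw [ENNReal.toReal_mul, ENNReal.toReal_add (by finiteness) (by finiteness),
      ENNReal.toReal_mul, ENNReal.toReal_ofReal (by positivity),
      ENNReal.toReal_ofReal (by positivity), ENNReal.toReal_ofReal (by positivity)]
  · have := hN.measurable_lintegral_marks β (1 - m)
    fun_prop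
  · filter_upwards [ae_restrict_mem measurableSet_Icc] with s hs
    have hs' : s ∈ Set.Icc (0 : ℝ) T := ⟨hs.1, hs.2.trans ht⟩
    have h1 := hN.lintegral_marks_ne_top hμ₀ hκ hα hβ hX hβ.le (1 - m) hs'
    finiteness

/-- The integral equation for the mixed second moments. -/
theorem IsMarkedHawkes.cross_eq {b b' : ℝ} (hb : 0 ≤ b) (hb' : 0 ≤ b') (m n : Fin 2) {t : ℝ}
    (ht : t ∈ Set.Icc (0 : ℝ) T) :
    cross P τ ε J b m b' n t = (∫ ω, X ω ∂P) * (∫ s in Set.Icc 0 t,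
        (Real.exp (b * s) * (μ₀ * Real.exp (κ * (s / T)) * mean P τ ε J b' n s +
          α * Real.exp (-β * s) * cross P τ ε J β (1 - m) b' n s) +
        Real.exp (b' * s) * (μ₀ * Real.exp (κ * (s / T)) * mean P τ ε J b m s +
          α * Real.exp (-β * s) * cross P τ ε J β (1 - n) b m s))) +
      (∫ ω, X ω ^ 2 ∂P) * ∫ s in Set.Icc 0 t, if m = n then
        Real.exp (b * s) * Real.exp (b' * s) * (μ₀ * Real.exp (κ * (s / T)) +
          α * Real.exp (-β * s) * mean P τ ε J β (1 - m) s) else 0 := by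
  have hr : ∀ k, Measurable fun s => ∫⁻ ω, rate T μ₀ κ α β τ ε J k s ω ∂P := fun k =>
    (hN.measurable_rate k).lintegral_prod_right'
  have hrm : ∀ k d l, Measurable fun s =>
      ∫⁻ ω, rate T μ₀ κ α β τ ε J k s ω * marks τ ε J (expWeight d l) s ω ∂P := fun k d l =>
    ((hN.measurable_rate k).mul
      (hN.measurable_marks (measurable_expWeight d l))).lintegral_prod_right'
  have hm1 := hN.measurable_lintegral_marks
  have hm2 := hN.measurable_lintegral_marks_mul
  have hw := measurable_expWeight
  -- An arrival has a single type, so the squared-size term survives only for `m = n`.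
  have hmn : ∀ s (x : Fin 2 → ℝ≥0∞), ∑ k, expWeight b m k s * expWeight b' n k s * x k =
      if m = n then ENNReal.ofReal (Real.exp (b * s)) * ENNReal.ofReal (Real.exp (b' * s)) * x m
        else 0 := by
    intro s x
    simp_rw [mul_assoc, sum_expWeight_mul]
    unfold expWeight
    split_ifs <;> simp
  have hfin1 : ∀ s ∈ Set.Icc 0 t, ∀ d, 0 ≤ d → ∀ k,
      ∫⁻ ω, marks τ ε J (expWeight d k) s ω ∂P ≠ ⊤ := fun s hs d hd k =>
    hN.lintegral_marks_ne_top hμ₀ hκ hα hβ hX hd k ⟨hs.1, hs.2.trans ht.2⟩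
  have hfin2 : ∀ s ∈ Set.Icc 0 t, ∀ d, 0 ≤ d → ∀ k l, ∫⁻ ω, marks τ ε J (expWeight β k) s ω *
      marks τ ε J (expWeight d l) s ω ∂P ≠ ⊤ := fun s hs d hd k l =>
    hN.lintegral_marks_mul_ne_top hμ₀ hκ hα hβ hX hβ.le hd k l ⟨hs.1, hs.2.trans ht.2⟩
  have e1 : ∫⁻ ω, marks τ ε J (expWeight b m) t ω * marks τ ε J (expWeight b' n) t ω ∂P =
      (∫⁻ ω, ENNReal.ofReal (X ω) ∂P) * (∫⁻ s in Set.Icc 0 t,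
        (ENNReal.ofReal (Real.exp (b * s)) * (ENNReal.ofReal (μ₀ * Real.exp (κ * (s / T))) *
          (∫⁻ ω, marks τ ε J (expWeight b' n) s ω ∂P) + ENNReal.ofReal (α * Real.exp (-β * s)) *
          ∫⁻ ω, marks τ ε J (expWeight β (1 - m)) s ω * marks τ ε J (expWeight b' n) s ω ∂P) +
        ENNReal.ofReal (Real.exp (b' * s)) * (ENNReal.ofReal (μ₀ * Real.exp (κ * (s / T))) *
          (∫⁻ ω, marks τ ε J (expWeight b m) s ω ∂P) + ENNReal.ofReal (α * Real.exp (-β * s)) *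
          ∫⁻ ω, marks τ ε J (expWeight β (1 - n)) s ω * marks τ ε J (expWeight b m) s ω ∂P))) +
      (∫⁻ ω, ENNReal.ofReal (X ω) ^ 2 ∂P) * ∫⁻ s in Set.Icc 0 t, if m = n then
        ENNReal.ofReal (Real.exp (b * s)) * ENNReal.ofReal (Real.exp (b' * s)) *
          (ENNReal.ofReal (μ₀ * Real.exp (κ * (s / T))) + ENNReal.ofReal (α * Real.exp (-β * s)) *
            ∫⁻ ω, marks τ ε J (expWeight β (1 - m)) s ω ∂P) else 0 := by
    have hadd : ∀ k, Measurable fun s => expWeight b m k s *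
        (∫⁻ ω, rate T μ₀ κ α β τ ε J k s ω * marks τ ε J (expWeight b' n) s ω ∂P) +
        expWeight b' n k s *
        ∫⁻ ω, rate T μ₀ κ α β τ ε J k s ω * marks τ ε J (expWeight b m) s ω ∂P := fun k =>
      ((hw b m k).mul (hrm k b' n)).add ((hw b' n k).mul (hrm k b m))
    have hmul : ∀ k, Measurable fun s => expWeight b m k s * expWeight b' n k s *
        ∫⁻ ω, rate T μ₀ κ α β τ ε J k s ω ∂P := fun k =>
      ((hw b m k).mul (hw b' n k)).mul (hr k)
    rw [hN.lintegral_marks_mul_marks hμ₀ hα hX.aestronglyMeasurable.aemeasurable (hw b m) (hw b' n)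
      ht.2, ← lintegral_finsetSum _ fun k _ => hadd k, ← lintegral_finsetSum _ fun k _ => hmul k]
    simp_rw [Finset.sum_add_distrib, sum_expWeight_mul, hmn, hN.lintegral_rate_mul,
      lintegral_rate]
  have hfinite := hN.lintegral_marks_mul_ne_top hμ₀ hκ hα hβ hX hb hb' m n ht
  have hexp : ∀ c s, 0 ≤ Real.exp (c * s) := fun c s => (Real.exp_pos _).le
  have hμe : ∀ s, 0 ≤ μ₀ * Real.exp (κ * (s / T)) := fun s => by positivity
  have hαe : ∀ s, 0 ≤ α * Real.exp (-β * s) := fun s => by positivity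
  rw [cross, e1]
  -- Finiteness of the moment on the left passes to both summands on the right, which permits
  -- splitting `toReal`.
  rw [e1] at hfinite
  obtain ⟨hfinite1, hfinite2⟩ := ENNReal.add_ne_top.1 hfinite
  rw [ENNReal.toReal_add hfinite1 hfinite2, ENNReal.toReal_mul, ENNReal.toReal_mul,
    hN.toReal_lintegral_ofReal hX, hN.toReal_lintegral_ofReal_sq hX, ← integral_toReal,
    ← integral_toReal]
  · congr 2
    · refine setIntegral_congr_fun measurableSet_Icc fun s hs => ?_
      have f1 := hfin1 s hs b' hb' n
      have f2 := hfin1 s hs b hb m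
      have f3 := hfin2 s hs b' hb' (1 - m) n
      have f4 := hfin2 s hs b hb (1 - n) m
      rw [ENNReal.toReal_add (mul_add_mul_ne_top _ _ _ f1 f3) (mul_add_mul_ne_top _ _ _ f2 f4),
        toReal_mul_add_mul (hexp _ _) (hμe _) (hαe _) f1 f3,
        toReal_mul_add_mul (hexp _ _) (hμe _) (hαe _) f2 f4]
      rfl
    · refine setIntegral_congr_fun measurableSet_Icc fun s hs => ?_
      have f1 := hfin1 s hs β hβ.le (1 - m)
      split_ifs
      · have h := toReal_mul_add_mul (mul_nonneg (hexp b s) (hexp b' s)) (hμe s) (hαe s)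
          ENNReal.one_ne_top f1
        rw [mul_one, ENNReal.toReal_one, mul_one, ENNReal.ofReal_mul (hexp b s)] at h
        exact h
      · rfl
  · split_ifs
    · have := hm1 β (1 - m)
      fun_prop
    · fun_prop
  · filter_upwards [ae_restrict_mem measurableSet_Icc] with s hs
    have f1 := hfin1 s hs β hβ.le (1 - m)
    split_ifs <;> finiteness
  · have hmeas : ∀ (d : ℝ) (x y : ℝ → ℝ≥0∞), Measurable x → Measurable y → Measurable fun s =>
        ENNReal.ofReal (Real.exp (d * s)) * (ENNReal.ofReal (μ₀ * Real.exp (κ * (s / T))) * x s +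
          ENNReal.ofReal (α * Real.exp (-β * s)) * y s) := by
      intro d x y hx hy
      fun_prop
    exact ((hmeas b _ _ (hm1 b' n) (hm2 β (1 - m) b' n)).add
      (hmeas b' _ _ (hm1 b m) (hm2 β (1 - n) b m))).aemeasurable
  · filter_upwards [ae_restrict_mem measurableSet_Icc] with s hs
    have f1 := hfin1 s hs b' hb' n
    have f2 := hfin1 s hs b hb m
    have f3 := hfin2 s hs b' hb' (1 - m) n
    have f4 := hfin2 s hs b hb (1 - n) m
    exact ENNReal.add_lt_top.2 ⟨(mul_add_mul_ne_top _ _ _ f1 f3).lt_top,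
      (mul_add_mul_ne_top _ _ _ f2 f4).lt_top⟩

end Moments

end MarkedHawkes

/-! ### Uniqueness for linear integral equations, and signed moments. -/

namespace MarkedHawkes

lemma integral_Icc_eq_sub {y g : ℝ → ℝ} (hy : ∀ t, HasDerivAt y (g t) t) (hg : Continuous g)
    {t : ℝ} (ht : 0 ≤ t) : ∫ s in Set.Icc 0 t, g s = y t - y 0 := by
  rw [integral_Icc_eq_integral_Ioc, ← intervalIntegral.integral_of_le ht]
  exact intervalIntegral.integral_eq_sub_of_hasDerivAt (fun s _ => hy s) (hg.intervalIntegrable _ _)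

lemma integrableOn_Icc_of_bounded {u : ℝ → ℝ} {t T C : ℝ} (hu : Measurable u)
    (hC : ∀ s ∈ Set.Icc 0 T, ‖u s‖ ≤ C) (ht : t ≤ T) : IntegrableOn u (Set.Icc 0 t) :=
  Measure.integrableOn_of_bounded (by simp) hu.aestronglyMeasurable
    ((ae_restrict_mem measurableSet_Icc).mono fun s hs => hC s ⟨hs.1, hs.2.trans ht⟩)

/-- A bounded solution of a linear integral equation agrees with the solution of the corresponding
linear differential equation. -/
lemma eq_of_eq_integral {u y r : ℝ → ℝ} {T k C : ℝ} (hu : Measurable u)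
    (hC : ∀ t ∈ Set.Icc 0 T, ‖u t‖ ≤ C) (hr : Continuous r)
    (hy : ∀ t, HasDerivAt y (k * y t + r t) t) (hy0 : y 0 = 0)
    (h : ∀ t ∈ Set.Icc 0 T, u t = ∫ s in Set.Icc 0 t, (k * u s + r s)) :
    ∀ t ∈ Set.Icc 0 T, u t = y t := by
  have hyc : Continuous y := continuous_iff_continuousAt.2 fun t => (hy t).continuousAt
  have hd : ∀ t ∈ Set.Icc 0 T, u t - y t = ∫ s in Set.Icc 0 t, k * (u s - y s) := by
    intro t ht
    have h1 : IntegrableOn (fun s => k * u s + r s) (Set.Icc 0 t) :=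
      ((integrableOn_Icc_of_bounded hu hC ht.2).const_mul k).add hr.continuousOn.integrableOn_Icc
    have h2 : Continuous fun s => k * y s + r s := by fun_prop
    have h3 := integral_Icc_eq_sub hy h2 ht.1
    rw [hy0, sub_zero] at h3
    rw [h t ht, ← h3, ← integral_sub h1 h2.continuousOn.integrableOn_Icc]
    refine integral_congr_ae (Filter.Eventually.of_forall fun s => ?_)
    ring
  obtain ⟨D, hD⟩ := (isCompact_Icc (a := (0 : ℝ)) (b := T)).exists_bound_of_continuousOn
    hyc.continuousOn
  -- The difference solves the homogeneous equation, so Grönwall with `C = 0` forces it to vanish;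
  -- `|k| + 1` stands for `|k|` to stay positive.
  have hz := le_of_le_add_lintegral (u := fun t => ‖u t - y t‖ₑ) (T := T) (K := |k| + 1)
    (by positivity) (B := ENNReal.ofReal (C + D)) (C := 0) ENNReal.ofReal_ne_top ?_ ?_
  · intro t ht
    have := hz t ht
    simp only [mul_zero, zero_mul, nonpos_iff_eq_zero, enorm_eq_zero] at this
    linarith
  · intro t ht
    rw [← ofReal_norm]
    exact ENNReal.ofReal_le_ofReal ((norm_sub_le _ _).trans (add_le_add (hC t ht) (hD t ht)))
  · intro t ht
    rw [zero_add]
    calc ‖u t - y t‖ₑ ≤ ∫⁻ s in Set.Icc 0 t, ‖k * (u s - y s)‖ₑ := by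
          rw [hd t ht]
          exact enorm_integral_le_lintegral_enorm _
      _ = ‖k‖ₑ * ∫⁻ s in Set.Icc 0 t, ‖u s - y s‖ₑ := by
          simp_rw [enorm_mul]
          rw [lintegral_const_mul' _ _ enorm_ne_top]
      _ ≤ _ := by
          gcongr
          rw [← ofReal_norm]
          exact ENNReal.ofReal_le_ofReal (by rw [Real.norm_eq_abs]; linarith)

variable {Ω : Type*} [mΩ : MeasurableSpace Ω]

/-- The second moment of the difference between the up and the down sums, with exponents `b`
and `b'`. -/
noncomputable def signedCross (P : Measure Ω) (τ : ℕ → Ω → ℝ≥0) (ε : ℕ → Ω → Fin 2)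
    (J : ℕ → Ω → ℝ) (b b' t : ℝ) : ℝ :=
  cross P τ ε J b 0 b' 0 t - cross P τ ε J b 0 b' 1 t - cross P τ ε J b 1 b' 0 t +
    cross P τ ε J b 1 b' 1 t

section Moments

variable {P : Measure Ω} {𝓕 : Filtration ℝ≥0 mΩ} {T : ℝ≥0}
  {μ₀ κ α β : ℝ} {X : Ω → ℝ} {τ : ℕ → Ω → ℝ≥0} {ε : ℕ → Ω → Fin 2} {J : ℕ → Ω → ℝ}

variable [IsProbabilityMeasure P]
  (hμ₀ : 0 < μ₀) (hκ : 0 < κ) (hα : 0 < α) (hβ : 0 < β) (hX : MemLp X 2 P)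
  (hN : IsMarkedHawkes P 𝓕 T (expBaseline μ₀ κ) (expExcitation α β) X τ ε J)

include hN in
lemma IsMarkedHawkes.measurable_signedCross (b b' : ℝ) :
    Measurable (signedCross P τ ε J b b') := by
  have := hN.measurable_cross
  exact (((this b 0 b' 0).sub (this b 0 b' 1)).sub (this b 1 b' 0)).add (this b 1 b' 1)

include hμ₀ hκ hα hβ hX hN

lemma IsMarkedHawkes.exists_signedCross_le {b b' : ℝ} (hb : 0 ≤ b) (hb' : 0 ≤ b') :
    ∃ C : ℝ, ∀ t ∈ Set.Icc (0 : ℝ) T, ‖signedCross P τ ε J b b' t‖ ≤ C := by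
  obtain ⟨C1, h1⟩ := hN.exists_cross_le hμ₀ hκ hα hβ hX hb hb' 0 0
  obtain ⟨C2, h2⟩ := hN.exists_cross_le hμ₀ hκ hα hβ hX hb hb' 0 1
  obtain ⟨C3, h3⟩ := hN.exists_cross_le hμ₀ hκ hα hβ hX hb hb' 1 0
  obtain ⟨C4, h4⟩ := hN.exists_cross_le hμ₀ hκ hα hβ hX hb hb' 1 1
  refine ⟨C1 + C2 + C3 + C4, fun t ht => ?_⟩
  unfold signedCross
  grw [norm_add_le, norm_sub_le, norm_sub_le, h1 t ht, h2 t ht, h3 t ht, h4 t ht]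

lemma IsMarkedHawkes.integrableOn_mean {b t : ℝ} (hb : 0 ≤ b) (m : Fin 2) (ht : t ≤ T) :
    IntegrableOn (mean P τ ε J b m) (Set.Icc 0 t) := by
  obtain ⟨C, hC⟩ := hN.exists_mean_le hμ₀ hκ hα hβ hX hb m
  exact integrableOn_Icc_of_bounded (hN.measurable_mean b m) hC ht

lemma IsMarkedHawkes.integrableOn_cross {b b' t : ℝ} (hb : 0 ≤ b) (hb' : 0 ≤ b') (m n : Fin 2)
    (ht : t ≤ T) : IntegrableOn (cross P τ ε J b m b' n) (Set.Icc 0 t) := by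
  obtain ⟨C, hC⟩ := hN.exists_cross_le hμ₀ hκ hα hβ hX hb hb' m n
  exact integrableOn_Icc_of_bounded (hN.measurable_cross b m b' n) hC ht

lemma IsMarkedHawkes.integrableOn_mean_rate {b t : ℝ} (m : Fin 2) (ht : t ≤ T) :
    IntegrableOn (fun s => Real.exp (b * s) * (μ₀ * Real.exp (κ * (s / T)) +
      α * Real.exp (-β * s) * mean P τ ε J β m s)) (Set.Icc 0 t) := by
  refine IntegrableOn.continuousOn_mul (by fun_prop) ?_ isCompact_Icc
  refine IntegrableOn.add (Continuous.integrableOn_Icc (by fun_prop)) ?_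
  exact IntegrableOn.continuousOn_mul (by fun_prop)
    (hN.integrableOn_mean hμ₀ hκ hα hβ hX hβ.le m ht) isCompact_Icc

/-- The integral equation for the sum of the means of the two types. -/
lemma IsMarkedHawkes.mean_add_mean_eq (b : ℝ) {t : ℝ} (ht : t ≤ T) :
    mean P τ ε J b 0 t + mean P τ ε J b 1 t = ∫ s in Set.Icc 0 t, (∫ ω, X ω ∂P) *
      Real.exp (b * s) * (2 * (μ₀ * Real.exp (κ * (s / T))) +
        α * Real.exp (-β * s) * (mean P τ ε J β 0 s + mean P τ ε J β 1 s)) := by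
  have h0 := hN.integrableOn_mean_rate hμ₀ hκ hα hβ hX (b := b) 0 ht
  have h1 := hN.integrableOn_mean_rate hμ₀ hκ hα hβ hX (b := b) 1 ht
  rw [hN.mean_eq hμ₀ hκ hα hβ hX 0 ht, hN.mean_eq hμ₀ hκ hα hβ hX 1 ht, sub_zero, sub_self,
    ← mul_add, ← integral_add h1 h0, ← integral_const_mul]
  refine integral_congr_ae (Filter.Eventually.of_forall fun s => ?_)
  ring

/-- The integral equation for the difference of the means of the two types. -/
lemma IsMarkedHawkes.mean_sub_mean_eq (b : ℝ) {t : ℝ} (ht : t ≤ T) :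
    mean P τ ε J b 0 t - mean P τ ε J b 1 t = ∫ s in Set.Icc 0 t, -((∫ ω, X ω ∂P) *
      Real.exp (b * s) * (α * Real.exp (-β * s) *
        (mean P τ ε J β 0 s - mean P τ ε J β 1 s))) := by
  have h0 := hN.integrableOn_mean_rate hμ₀ hκ hα hβ hX (b := b) 0 ht
  have h1 := hN.integrableOn_mean_rate hμ₀ hκ hα hβ hX (b := b) 1 ht
  rw [hN.mean_eq hμ₀ hκ hα hβ hX 0 ht, hN.mean_eq hμ₀ hκ hα hβ hX 1 ht, sub_zero, sub_self,
    ← mul_sub, ← integral_sub h1 h0, ← integral_const_mul]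
  refine integral_congr_ae (Filter.Eventually.of_forall fun s => ?_)
  ring

/-- The integral equation for the signed second moments. -/
lemma IsMarkedHawkes.signedCross_eq {b b' : ℝ} (hb : 0 ≤ b) (hb' : 0 ≤ b') {t : ℝ}
    (ht : t ∈ Set.Icc (0 : ℝ) T) :
    signedCross P τ ε J b b' t = ∫ s in Set.Icc 0 t,
      (-((∫ ω, X ω ∂P) * (α * Real.exp (-β * s)) * (Real.exp (b * s) * signedCross P τ ε J β b' s +
        Real.exp (b' * s) * signedCross P τ ε J β b s)) +
      (∫ ω, X ω ^ 2 ∂P) * (Real.exp (b * s) * Real.exp (b' * s) *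
        (2 * (μ₀ * Real.exp (κ * (s / T))) +
          α * Real.exp (-β * s) * (mean P τ ε J β 0 s + mean P τ ε J β 1 s)))) := by
  have hA : ∀ m n, IntegrableOn (fun s =>
      (Real.exp (b * s) * (μ₀ * Real.exp (κ * (s / T)) * mean P τ ε J b' n s +
          α * Real.exp (-β * s) * cross P τ ε J β (1 - m) b' n s) +
        Real.exp (b' * s) * (μ₀ * Real.exp (κ * (s / T)) * mean P τ ε J b m s +
          α * Real.exp (-β * s) * cross P τ ε J β (1 - n) b m s))) (Set.Icc 0 t) := by
    intro m n
    refine IntegrableOn.add ?_ ?_ <;>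
      refine IntegrableOn.continuousOn_mul (by fun_prop) (IntegrableOn.add ?_ ?_) isCompact_Icc <;>
      refine IntegrableOn.continuousOn_mul (by fun_prop) ?_ isCompact_Icc
    · exact hN.integrableOn_mean hμ₀ hκ hα hβ hX hb' n ht.2
    · exact hN.integrableOn_cross hμ₀ hκ hα hβ hX hβ.le hb' _ _ ht.2
    · exact hN.integrableOn_mean hμ₀ hκ hα hβ hX hb m ht.2
    · exact hN.integrableOn_cross hμ₀ hκ hα hβ hX hβ.le hb _ _ ht.2
  have hB : ∀ m, IntegrableOn (fun s =>
      Real.exp (b * s) * Real.exp (b' * s) * (μ₀ * Real.exp (κ * (s / T)) +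
          α * Real.exp (-β * s) * mean P τ ε J β (1 - m) s)) (Set.Icc 0 t) := by
    intro m
    simp_rw [mul_assoc (Real.exp (b * _))]
    exact IntegrableOn.continuousOn_mul (by fun_prop)
      (hN.integrableOn_mean_rate hμ₀ hκ hα hβ hX (1 - m) ht.2) isCompact_Icc
  have e01 : ((0 : Fin 2) = 1) = False := by simp
  have e10 : ((1 : Fin 2) = 0) = False := by simp
  rw [signedCross, hN.cross_eq hμ₀ hκ hα hβ hX hb hb' 0 0 ht,
    hN.cross_eq hμ₀ hκ hα hβ hX hb hb' 0 1 ht, hN.cross_eq hμ₀ hκ hα hβ hX hb hb' 1 0 ht,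
    hN.cross_eq hμ₀ hκ hα hβ hX hb hb' 1 1 ht]
  simp only [e01, e10, if_true, if_false, integral_zero, mul_zero, add_zero]
  have hint := (((((hA 0 0).sub (hA 0 1)).sub (hA 1 0)).add (hA 1 1)).const_mul (∫ ω, X ω ∂P))
  have hint' := ((hB 0).add (hB 1)).const_mul (∫ ω, X ω ^ 2 ∂P)
  have key := integral_add hint hint'
  have e1 := integral_add (((hA 0 0).sub (hA 0 1)).sub (hA 1 0)) (hA 1 1)
  have e2 := integral_sub ((hA 0 0).sub (hA 0 1)) (hA 1 0)
  have e3 := integral_sub (hA 0 0) (hA 0 1)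
  have e4 := integral_add (hB 0) (hB 1)
  simp only [Pi.add_apply, Pi.sub_apply] at key e1 e2 e3 e4
  rw [integral_const_mul, integral_const_mul, e4, e1, e2, e3] at key
  trans
  · exact (by ring : _ = _).trans key.symm
  -- In the signed combination the baseline terms cancel, and replacing a type by its opposite
  -- reverses the sign of the excitation terms.
  · refine integral_congr_ae (Filter.Eventually.of_forall fun s => ?_)
    simp only [sub_zero, sub_self, signedCross]
    ring

end Moments

end MarkedHawkes

/-! ### Explicit solution of the triangular system. -/

namespace MarkedHawkes

lemma hasDerivAt_mul_exp (p k t : ℝ) :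
    HasDerivAt (fun t => p * Real.exp (k * t)) (p * (k * Real.exp (k * t))) t := by
  have h1 : HasDerivAt (fun s : ℝ => k * s) k t := by simpa using (hasDerivAt_id t).const_mul k
  have h2 := h1.exp.const_mul p
  rwa [mul_comm (Real.exp (k * t)) k] at h2

variable {Ω : Type*} [mΩ : MeasurableSpace Ω]

section Moments

variable {P : Measure Ω} {𝓕 : Filtration ℝ≥0 mΩ} {T : ℝ≥0}
  {μ₀ κ α β : ℝ} {X : Ω → ℝ} {τ : ℕ → Ω → ℝ≥0} {ε : ℕ → Ω → Fin 2} {J : ℕ → Ω → ℝ}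

variable [IsProbabilityMeasure P]
  (hμ₀ : 0 < μ₀) (hκ : 0 < κ) (hα : 0 < α) (hβ : 0 < β) (hX : MemLp X 2 P)
  (hN : IsMarkedHawkes P 𝓕 T (expBaseline μ₀ κ) (expExcitation α β) X τ ε J)

include hμ₀ hκ hα hβ hX hN

/-- The up and the down moves have the same mean. -/
lemma IsMarkedHawkes.mean_sub_mean_eq_zero (b : ℝ) {t : ℝ}
    (ht : t ∈ Set.Icc (0 : ℝ) T) : mean P τ ε J b 0 t - mean P τ ε J b 1 t = 0 := by
  -- For the exponent `β` the difference solves `u' = -a u`, `u(0) = 0`; any other exponent is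
  -- obtained by integrating this one.
  have hβ0 : ∀ t ∈ Set.Icc (0 : ℝ) T, mean P τ ε J β 0 t - mean P τ ε J β 1 t = 0 := by
    obtain ⟨C0, h0⟩ := hN.exists_mean_le hμ₀ hκ hα hβ hX hβ.le 0
    obtain ⟨C1, h1⟩ := hN.exists_mean_le hμ₀ hκ hα hβ hX hβ.le 1
    refine eq_of_eq_integral (y := fun _ => 0) (r := fun _ => 0) (k := -(α * ∫ ω, X ω ∂P))
      (u := fun t => mean P τ ε J β 0 t - mean P τ ε J β 1 t)
      ((hN.measurable_mean β 0).sub (hN.measurable_mean β 1)) (C := C0 + C1)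
      (fun t ht => ?_) continuous_const (fun t => ?_) rfl fun t ht => ?_
    · grw [norm_sub_le, h0 t ht, h1 t ht]
    · simpa using hasDerivAt_const t (0 : ℝ)
    · rw [hN.mean_sub_mean_eq hμ₀ hκ hα hβ hX β ht.2]
      refine setIntegral_congr_fun measurableSet_Icc fun s _ => ?_
      have he : Real.exp (β * s) * Real.exp (-β * s) = 1 := by
        rw [← Real.exp_add]
        simp
      linear_combination -((∫ ω, X ω ∂P) * α * (mean P τ ε J β 0 s - mean P τ ε J β 1 s)) * he
  rw [hN.mean_sub_mean_eq hμ₀ hκ hα hβ hX b ht.2]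
  refine setIntegral_eq_zero_of_forall_eq_zero fun s hs => ?_
  rw [hβ0 s ⟨hs.1, hs.2.trans ht.2⟩]
  ring

/-- The explicit sum of the discounted means of the two types. -/
lemma IsMarkedHawkes.mean_add_mean_solution {c a : ℝ} (hc : c = κ / T) (ha : a = α * ∫ ω, X ω ∂P)
    (hca : c + β - a ≠ 0) : ∀ t ∈ Set.Icc (0 : ℝ) T,
    mean P τ ε J β 0 t + mean P τ ε J β 1 t =
      2 * μ₀ * (∫ ω, X ω ∂P) / (c + β - a) * Real.exp ((c + β) * t) +
        -(2 * μ₀ * (∫ ω, X ω ∂P) / (c + β - a)) * Real.exp (a * t) := by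
  obtain ⟨C0, h0⟩ := hN.exists_mean_le hμ₀ hκ hα hβ hX hβ.le 0
  obtain ⟨C1, h1⟩ := hN.exists_mean_le hμ₀ hκ hα hβ hX hβ.le 1
  -- The equation is `u' = a u + 2 μ₀ E(J) e^{(c+β)t}`; `e^{at}` is the homogeneous solution that
  -- cancels the value at `0`.
  refine eq_of_eq_integral (k := a)
    (r := fun t => 2 * μ₀ * (∫ ω, X ω ∂P) * Real.exp ((c + β) * t))
    (u := fun t => mean P τ ε J β 0 t + mean P τ ε J β 1 t)
    ((hN.measurable_mean β 0).add (hN.measurable_mean β 1)) (C := C0 + C1)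
    (fun t ht => ?_) (by fun_prop) (fun t => ?_) (by simp) fun t ht => ?_
  · grw [norm_add_le, h0 t ht, h1 t ht]
  · refine ((hasDerivAt_mul_exp _ _ t).add (hasDerivAt_mul_exp _ _ t)).congr_deriv ?_
    field_simp
    ring
  · rw [hN.mean_add_mean_eq hμ₀ hκ hα hβ hX β ht.2]
    refine setIntegral_congr_fun measurableSet_Icc fun s _ => ?_
    have he : Real.exp (β * s) * Real.exp (-β * s) = 1 := by
      rw [← Real.exp_add]
      simp
    have he' : Real.exp ((c + β) * s) = Real.exp (β * s) * Real.exp (κ * (s / T)) := by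
      rw [← Real.exp_add, hc]
      ring_nf
    simp only [he']
    linear_combination ((∫ ω, X ω ∂P) * α * (mean P τ ε J β 0 s + mean P τ ε J β 1 s)) * he -
      (mean P τ ε J β 0 s + mean P τ ε J β 1 s) * ha

/-- The mean of the total intensity. -/
lemma IsMarkedHawkes.mean_intensity {c a : ℝ} (hc : c = κ / T) (ha : a = α * ∫ ω, X ω ∂P)
    (hca : c + β - a ≠ 0) {s : ℝ} (hs : s ∈ Set.Icc (0 : ℝ) T) :
    2 * (μ₀ * Real.exp (κ * (s / T))) +
      α * Real.exp (-β * s) * (mean P τ ε J β 0 s + mean P τ ε J β 1 s) =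
    2 * μ₀ * ((c + β) / (c + β - a) * Real.exp (c * s) -
      a / (c + β - a) * Real.exp ((a - β) * s)) := by
  have he1 : Real.exp ((c + β) * s) * Real.exp (-β * s) = Real.exp (c * s) := by
    rw [← Real.exp_add]
    ring_nf
  have he2 : Real.exp (a * s) * Real.exp (-β * s) = Real.exp ((a - β) * s) := by
    rw [← Real.exp_add]
    ring_nf
  have he3 : Real.exp (κ * (s / T)) = Real.exp (c * s) := by
    rw [hc]
    ring_nf
  rw [hN.mean_add_mean_solution hμ₀ hκ hα hβ hX hc ha hca s hs, he3, ← he1, ← he2]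
  field_simp
  rw [ha]
  ring

/-- The explicit second moment of the difference of the excitations. -/
lemma IsMarkedHawkes.signedCross_excitation {c a D : ℝ} (hc : c = κ / T)
    (ha : a = α * ∫ ω, X ω ∂P) (hD : D = ∫ ω, X ω ^ 2 ∂P) (hca : c + β - a ≠ 0)
    (h1 : 2 * β + c + 2 * a ≠ 0) (h2 : β + 3 * a ≠ 0) :
    ∀ t ∈ Set.Icc (0 : ℝ) T, signedCross P τ ε J β β t =
      2 * μ₀ * D * ((c + β) / (c + β - a) / (2 * β + c + 2 * a)) * Real.exp ((2 * β + c) * t) +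
      -(2 * μ₀ * D * (a / (c + β - a) / (β + 3 * a))) * Real.exp ((β + a) * t) +
      2 * μ₀ * D * (a / (c + β - a) / (β + 3 * a) - (c + β) / (c + β - a) / (2 * β + c + 2 * a)) *
        Real.exp (-2 * a * t) := by
  obtain ⟨C, hC⟩ := hN.exists_signedCross_le hμ₀ hκ hα hβ hX hβ.le hβ.le
  -- Each source coefficient is divided by its exponent plus `2a`, giving `2β + c + 2a` and `β +
  -- 3a`; the `e^{-2at}` term restores the value `0` at time `0`.
  refine eq_of_eq_integral (k := -2 * a)
    (r := fun t => 2 * μ₀ * D * ((c + β) / (c + β - a) * Real.exp ((2 * β + c) * t) -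
      a / (c + β - a) * Real.exp ((β + a) * t)))
    (hN.measurable_signedCross β β) hC (by fun_prop) (fun t => ?_) ?_ fun t ht => ?_
  · refine (((hasDerivAt_mul_exp _ _ t).add (hasDerivAt_mul_exp _ _ t)).add
      (hasDerivAt_mul_exp _ _ t)).congr_deriv ?_
    have h2' : β + a * 3 ≠ 0 := by rwa [mul_comm]
    field_simp
    ring
  · simp only [mul_zero, Real.exp_zero]
    ring
  · rw [hN.signedCross_eq hμ₀ hκ hα hβ hX hβ.le hβ.le ht]
    refine setIntegral_congr_fun measurableSet_Icc fun s hs => ?_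
    have hs' : s ∈ Set.Icc (0 : ℝ) T := ⟨hs.1, hs.2.trans ht.2⟩
    have he : Real.exp (-β * s) * Real.exp (β * s) = 1 := by
      rw [← Real.exp_add]
      simp
    have he1 : Real.exp ((2 * β + c) * s) =
        Real.exp (β * s) * Real.exp (β * s) * Real.exp (c * s) := by
      rw [← Real.exp_add, ← Real.exp_add]
      ring_nf
    have he2 : Real.exp ((β + a) * s) =
        Real.exp (β * s) * Real.exp (β * s) * Real.exp ((a - β) * s) := by
      rw [← Real.exp_add, ← Real.exp_add]
      ring_nf
    simp only [hN.mean_intensity hμ₀ hκ hα hβ hX hc ha hca hs', he1, he2, ← hD]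
    linear_combination (-2 * (∫ ω, X ω ∂P) * α * signedCross P τ ε J β β s) * he +
      2 * signedCross P τ ε J β β s * ha

/-- The explicit mixed moment of the price move and the difference of the excitations. -/
lemma IsMarkedHawkes.signedCross_move_excitation {c a D q : ℝ} (hc : c = κ / T)
    (ha : a = α * ∫ ω, X ω ∂P) (hD : D = ∫ ω, X ω ^ 2 ∂P) (hca : c + β - a ≠ 0)
    (h1 : 2 * β + c + 2 * a ≠ 0) (h2 : β + 3 * a ≠ 0) (h3 : β + a ≠ 0) (h4 : β + c + a ≠ 0)
    (hq : q = a / (c + β - a) / (β + 3 * a) - (c + β) / (c + β - a) / (2 * β + c + 2 * a)) :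
    ∀ t ∈ Set.Icc (0 : ℝ) T, signedCross P τ ε J β 0 t =
      2 * μ₀ * D * ((c + β) * (2 * β + c + a) / ((c + β - a) * (2 * β + c + 2 * a) * (β + c + a))) *
        Real.exp ((β + c) * t) +
      -(2 * μ₀ * D * ((β + 2 * a) / (2 * (c + β - a) * (β + 3 * a)))) * Real.exp (a * t) +
      2 * μ₀ * D * (a * q / (β + a)) * Real.exp (-(2 * a + β) * t) +
      2 * μ₀ * D * (-((c + β) * (2 * β + c + a) /
          ((c + β - a) * (2 * β + c + 2 * a) * (β + c + a))) +
        (β + 2 * a) / (2 * (c + β - a) * (β + 3 * a)) - a * q / (β + a)) * Real.exp (-a * t) := by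
  obtain ⟨C, hC⟩ := hN.exists_signedCross_le hμ₀ hκ hα hβ hX hβ.le le_rfl
  have hQ := hN.signedCross_excitation hμ₀ hκ hα hβ hX hc ha hD hca h1 h2
  rw [← hq] at hQ
  -- The source is `D e^{βt}` times the mean total intensity minus `a e^{-βt}` times the excitation
  -- moment. Source coefficients are divided by exponent plus `a`; for `e^{at}` the divisor `2a`
  -- cancels against a factor `a` of the coefficient.
  refine eq_of_eq_integral (k := -a)
    (r := fun t => 2 * μ₀ * D * (((c + β) / (c + β - a) -
        a * ((c + β) / (c + β - a) / (2 * β + c + 2 * a))) * Real.exp ((β + c) * t) -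
      (a / (c + β - a) - a * (a / (c + β - a) / (β + 3 * a))) * Real.exp (a * t) -
      a * q * Real.exp (-(2 * a + β) * t)))
    (hN.measurable_signedCross β 0) hC (by fun_prop) (fun t => ?_) ?_ fun t ht => ?_
  · refine ((((hasDerivAt_mul_exp _ _ t).add (hasDerivAt_mul_exp _ _ t)).add
      (hasDerivAt_mul_exp _ _ t)).add (hasDerivAt_mul_exp _ _ t)).congr_deriv ?_
    have h2' : β + a * 3 ≠ 0 := by rwa [mul_comm]
    field_simp
    ring
  · simp only [mul_zero, Real.exp_zero]
    ring
  · rw [hN.signedCross_eq hμ₀ hκ hα hβ hX hβ.le le_rfl ht]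
    refine setIntegral_congr_fun measurableSet_Icc fun s hs => ?_
    have hs' : s ∈ Set.Icc (0 : ℝ) T := ⟨hs.1, hs.2.trans ht.2⟩
    have he : Real.exp (-β * s) * Real.exp (β * s) = 1 := by
      rw [← Real.exp_add]
      simp
    have he1 : Real.exp ((β + c) * s) = Real.exp (β * s) * Real.exp (c * s) := by
      rw [← Real.exp_add]
      ring_nf
    have he2 : Real.exp (a * s) = Real.exp (β * s) * Real.exp ((a - β) * s) := by
      rw [← Real.exp_add]
      ring_nf
    have he3 : Real.exp (-(2 * a + β) * s) = Real.exp (-β * s) * Real.exp (-2 * a * s) := by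
      rw [← Real.exp_add]
      ring_nf
    have he4 : Real.exp (-β * s) * Real.exp ((2 * β + c) * s) =
        Real.exp (β * s) * Real.exp (c * s) := by
      rw [← Real.exp_add, ← Real.exp_add]
      ring_nf
    have he5 : Real.exp (-β * s) * Real.exp ((β + a) * s) =
        Real.exp (β * s) * Real.exp ((a - β) * s) := by
      rw [← Real.exp_add, ← Real.exp_add]
      ring_nf
    have hsw : signedCross P τ ε J β β s * Real.exp (-β * s) =
        2 * μ₀ * D * ((c + β) / (c + β - a) / (2 * β + c + 2 * a)) *
          (Real.exp (β * s) * Real.exp (c * s)) +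
        -(2 * μ₀ * D * (a / (c + β - a) / (β + 3 * a))) *
          (Real.exp (β * s) * Real.exp ((a - β) * s)) +
        2 * μ₀ * D * q * (Real.exp (-β * s) * Real.exp (-2 * a * s)) := by
      rw [hQ s hs', ← he4, ← he5]
      ring
    simp only [hN.mean_intensity hμ₀ hκ hα hβ hX hc ha hca hs', he1, he2, he3, ← hD, zero_mul,
      Real.exp_zero]
    have ha' : (∫ ω, X ω ∂P) * α = a := by rw [ha, mul_comm]
    linear_combination (-signedCross P τ ε J β 0 s * Real.exp (-β * s) * Real.exp (β * s) -
      signedCross P τ ε J β β s * Real.exp (-β * s)) * ha' -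
      a * signedCross P τ ε J β 0 s * he - a * hsw

/-- The second moment of the price move. -/
lemma IsMarkedHawkes.signedCross_move {c a D C₁ C₂ C₃ C₄ : ℝ} (hc : c = κ / T)
    (ha : a = α * ∫ ω, X ω ∂P) (hD : D = ∫ ω, X ω ^ 2 ∂P) (hc0 : 0 < c) (ha0 : 0 ≤ a)
    (haβ : a < β)
    (hC₁ : C₁ = -a ^ 2 / ((β - a) * (β + 3 * a) * (β - a + c)))
    (hC₂ : C₂ = a ^ 2 * (β + 2 * a) / ((β + a) ^ 2 * (β + 3 * a) * (2 * β + 2 * a + c)))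
    (hC₃ : C₃ = a * β / ((β + a) ^ 2 * (β + a + c)))
    (hC₄ : C₄ = β ^ 3 / (c * (β + a) ^ 2 * (β - a))) {t : ℝ} (ht : t ∈ Set.Icc (0 : ℝ) T) :
    signedCross P τ ε J 0 0 t = 2 * μ₀ * D *
      ((C₁ + C₂ + C₃ + C₄) * Real.exp (c * t) - C₁ * Real.exp ((a - β) * t) -
        C₂ * Real.exp (-2 * (β + a) * t) - C₃ * Real.exp (-(β + a) * t) - C₄) := by
  have hca : c + β - a ≠ 0 := by linarith
  have hca' : β - a + c ≠ 0 := by linarith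
  have hβa : β - a ≠ 0 := by linarith
  have h1 : 2 * β + c + 2 * a ≠ 0 := by positivity
  have h1' : 2 * β + 2 * a + c ≠ 0 := by positivity
  have h2 : β + 3 * a ≠ 0 := by positivity
  have h2' : β + a * 3 ≠ 0 := by positivity
  have h3 : β + a ≠ 0 := by positivity
  have h4 : β + c + a ≠ 0 := by positivity
  have h4' : β + a + c ≠ 0 := by positivity
  have hG := hN.signedCross_move_excitation hμ₀ hκ hα hβ hX hc ha hD hca h1 h2 h3 h4 rfl
  -- `k1` to `k4` match the coefficients of `e^{cs}`, `e^{(a-β)s}`, `e^{-2(β+a)s}` and `e^{-(β+a)s}`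
  -- in the derivative with those of the claimed formula. `C₄` enters only through `k1`.
  have k1 : (c + β) / (c + β - a) - 2 * a * ((c + β) * (2 * β + c + a) /
      ((c + β - a) * (2 * β + c + 2 * a) * (β + c + a))) = c * (C₁ + C₂ + C₃ + C₄) := by
    rw [hC₁, hC₂, hC₃, hC₄]
    field_simp
    ring
  have k2 : -(a / (c + β - a)) + 2 * a * ((β + 2 * a) / (2 * (c + β - a) * (β + 3 * a))) =
      (β - a) * C₁ := by
    rw [hC₁]
    field_simp
    ring
  have k3 : -2 * a * (a * (a / (c + β - a) / (β + 3 * a) -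
      (c + β) / (c + β - a) / (2 * β + c + 2 * a)) / (β + a)) = 2 * (β + a) * C₂ := by
    rw [hC₂]
    field_simp
    ring
  have k4 : -2 * a * (-((c + β) * (2 * β + c + a) /
          ((c + β - a) * (2 * β + c + 2 * a) * (β + c + a))) +
        (β + 2 * a) / (2 * (c + β - a) * (β + 3 * a)) -
        a * (a / (c + β - a) / (β + 3 * a) -
      (c + β) / (c + β - a) / (2 * β + c + 2 * a)) / (β + a)) = (β + a) * C₃ := by
    rw [hC₃]
    field_simp
    ring
  rw [hN.signedCross_eq hμ₀ hκ hα hβ hX le_rfl le_rfl ht]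
  have hcongr : ∀ s ∈ Set.Icc 0 t,
      -((∫ ω, X ω ∂P) * (α * Real.exp (-β * s)) * (Real.exp (0 * s) * signedCross P τ ε J β 0 s +
        Real.exp (0 * s) * signedCross P τ ε J β 0 s)) +
      (∫ ω, X ω ^ 2 ∂P) * (Real.exp (0 * s) * Real.exp (0 * s) *
        (2 * (μ₀ * Real.exp (κ * (s / T))) +
          α * Real.exp (-β * s) * (mean P τ ε J β 0 s + mean P τ ε J β 1 s))) =
      2 * μ₀ * D * (C₁ + C₂ + C₃ + C₄) * (c * Real.exp (c * s)) +
        -(2 * μ₀ * D * C₁) * ((a - β) * Real.exp ((a - β) * s)) +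
        -(2 * μ₀ * D * C₂) * (-2 * (β + a) * Real.exp (-2 * (β + a) * s)) +
        -(2 * μ₀ * D * C₃) * (-(β + a) * Real.exp (-(β + a) * s)) := by
    intro s hs
    have hs' : s ∈ Set.Icc (0 : ℝ) T := ⟨hs.1, hs.2.trans ht.2⟩
    have he1 : Real.exp (-β * s) * Real.exp ((β + c) * s) = Real.exp (c * s) := by
      rw [← Real.exp_add]
      ring_nf
    have he2 : Real.exp (-β * s) * Real.exp (a * s) = Real.exp ((a - β) * s) := by
      rw [← Real.exp_add]
      ring_nf
    have he3 : Real.exp (-β * s) * Real.exp (-(2 * a + β) * s) =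
        Real.exp (-2 * (β + a) * s) := by
      rw [← Real.exp_add]
      ring_nf
    have he4 : Real.exp (-β * s) * Real.exp (-a * s) = Real.exp (-(β + a) * s) := by
      rw [← Real.exp_add]
      ring_nf
    have ha' : (∫ ω, X ω ∂P) * (α * Real.exp (-β * s)) = a * Real.exp (-β * s) := by
      rw [ha]
      ring
    rw [hN.mean_intensity hμ₀ hκ hα hβ hX hc ha hca hs', hG s hs', ha', ← hD, zero_mul,
      Real.exp_zero, ← he1, ← he2, ← he3, ← he4]
    linear_combination 2 * μ₀ * D * Real.exp (-β * s) *
      (Real.exp ((β + c) * s) * k1 + Real.exp (a * s) * k2 +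
        Real.exp (-(2 * a + β) * s) * k3 + Real.exp (-a * s) * k4)
  rw [setIntegral_congr_fun measurableSet_Icc hcongr, integral_Icc_eq_sub (fun s =>
    (((hasDerivAt_mul_exp _ _ s).add (hasDerivAt_mul_exp _ _ s)).add
      (hasDerivAt_mul_exp _ _ s)).add (hasDerivAt_mul_exp _ _ s)) (by fun_prop) ht.1]
  simp only [Pi.add_apply, mul_zero, Real.exp_zero]
  ring

end Moments

end MarkedHawkes

/-! ### From the signed moments to the price. -/

namespace MarkedHawkes

variable {Ω : Type*} [mΩ : MeasurableSpace Ω]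

section Moments

variable {P : Measure Ω} {𝓕 : Filtration ℝ≥0 mΩ} {T : ℝ≥0}
  {μ₀ κ α β : ℝ} {X : Ω → ℝ} {τ : ℕ → Ω → ℝ≥0} {ε : ℕ → Ω → Fin 2} {J : ℕ → Ω → ℝ}

omit mΩ in
lemma moves_eq_toReal {ω : Ω} (hfin : {i | τ i ω ≤ T}.Finite) (hJ : ∀ i, 0 < J i ω) {t : ℝ}
    (ht : t ≤ T) (m : Fin 2) :
    moves τ ε J m t ω = (marks τ ε J (expWeight 0 m) t ω).toReal := by
  have h := ofReal_markIntegral (ε := ε) hfin ht hJ (h := fun _ => 1) (fun _ => zero_le_one) m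
  have hw : (fun n (_ : ℝ) => if n = m then ENNReal.ofReal 1 else 0) = expWeight 0 m := by
    ext n s
    simp [expWeight]
  rw [hw] at h
  rw [← h, ENNReal.toReal_ofReal (markIntegral_nonneg hJ (fun _ => zero_le_one) m), moves]

variable [IsProbabilityMeasure P]
  (hμ₀ : 0 < μ₀) (hκ : 0 < κ) (hα : 0 < α) (hβ : 0 < β) (hX : MemLp X 2 P)
  (hN : IsMarkedHawkes P 𝓕 T (expBaseline μ₀ κ) (expExcitation α β) X τ ε J)

include hμ₀ hκ hα hβ hX hN

/-- The second moment of the price in terms of the signed second moment of the moves. -/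
lemma IsMarkedHawkes.integral_price_sq (f₀ : ℝ) {t : ℝ} (ht : t ∈ Set.Icc (0 : ℝ) T) :
    Integrable (fun ω => price f₀ τ ε J t ω ^ 2) P ∧
    ∫ ω, price f₀ τ ε J t ω ^ 2 ∂P = f₀ ^ 2 + signedCross P τ ε J 0 0 t := by
  set x : Fin 2 → Ω → ℝ := fun m ω => (marks τ ε J (expWeight 0 m) t ω).toReal with hx
  have hm : ∀ m, Measurable fun ω => marks τ ε J (expWeight 0 m) t ω := fun m =>
    hN.measurable_marks_apply (measurable_expWeight 0 m) t
  have hfinite1 := fun m => hN.lintegral_marks_ne_top hμ₀ hκ hα hβ hX le_rfl m ht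
  have hfinite2 := fun m n => hN.lintegral_marks_mul_ne_top hμ₀ hκ hα hβ hX le_rfl le_rfl m n ht
  have hint1 : ∀ m, Integrable (x m) P := fun m =>
    integrable_toReal_of_lintegral_ne_top (hm m).aemeasurable (hfinite1 m)
  have hint2 : ∀ m n, Integrable (fun ω => x m ω * x n ω) P := by
    intro m n
    have h := integrable_toReal_of_lintegral_ne_top ((hm m).mul (hm n)).aemeasurable (hfinite2 m n)
    simpa only [Pi.mul_apply, ENNReal.toReal_mul] using h
  have he1 : ∀ m, ∫ ω, x m ω ∂P = mean P τ ε J 0 m t := fun m =>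
    integral_toReal (hm m).aemeasurable (ae_lt_top (hm m) (hfinite1 m))
  have he2 : ∀ m n, ∫ ω, x m ω * x n ω ∂P = cross P τ ε J 0 m 0 n t := by
    intro m n
    have h := integral_toReal ((hm m).mul (hm n)).aemeasurable
      (ae_lt_top ((hm m).mul (hm n)) (hfinite2 m n))
    simp only [Pi.mul_apply, ENNReal.toReal_mul] at h
    exact h
  have hprice : (fun ω => price f₀ τ ε J t ω ^ 2) =ᵐ[P] fun ω =>
      f₀ ^ 2 + 2 * f₀ * (x 0 ω - x 1 ω) +
        (x 0 ω * x 0 ω - x 0 ω * x 1 ω - x 1 ω * x 0 ω + x 1 ω * x 1 ω) := by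
    filter_upwards [hN.locally_finite] with ω hω
    have hJ := fun i => hN.size_pos i ω
    rw [price, moves_eq_toReal hω hJ ht.2, moves_eq_toReal hω hJ ht.2]
    ring
  have hi0 : Integrable (fun ω => x 0 ω - x 1 ω) P := (hint1 0).sub (hint1 1)
  have hi1 : Integrable (fun ω => f₀ ^ 2 + 2 * f₀ * (x 0 ω - x 1 ω)) P :=
    (integrable_const _).add (hi0.const_mul _)
  have hi3 : Integrable (fun ω => x 0 ω * x 0 ω - x 0 ω * x 1 ω) P := (hint2 0 0).sub (hint2 0 1)
  have hi4 : Integrable (fun ω => x 0 ω * x 0 ω - x 0 ω * x 1 ω - x 1 ω * x 0 ω) P :=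
    hi3.sub (hint2 1 0)
  have hi2 : Integrable (fun ω =>
      x 0 ω * x 0 ω - x 0 ω * x 1 ω - x 1 ω * x 0 ω + x 1 ω * x 1 ω) P := hi4.add (hint2 1 1)
  refine ⟨(hi1.add hi2).congr hprice.symm, ?_⟩
  rw [integral_congr_ae hprice, integral_add hi1 hi2, integral_add hi4 (hint2 1 1),
    integral_sub hi3 (hint2 1 0), integral_sub (hint2 0 0) (hint2 0 1),
    integral_add (integrable_const _) (hi0.const_mul _), integral_const_mul]
  -- Equal means of up and down moves remove the term linear in `f₀`.
  have hsub : ∫ ω, (x 0 ω - x 1 ω) ∂P = 0 := by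
    rw [integral_sub (hint1 0) (hint1 1), he1, he1]
    exact hN.mean_sub_mean_eq_zero hμ₀ hκ hα hβ hX 0 ht
  rw [he2, he2, he2, he2, hsub, signedCross]
  simp

end Moments

end MarkedHawkes

theorem proposition3p2 {Ω : Type*} [MeasurableSpace Ω] (P : Measure Ω) [IsProbabilityMeasure P]
    (𝓕 : Filtration ℝ≥0 ‹MeasurableSpace Ω›) (T : ℝ≥0) (hT : 0 < T)
    (μ₀ κ α β : ℝ) (hμ₀ : 0 < μ₀) (hκ : 0 < κ) (hα : 0 < α) (hβ : 0 < β)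
    (X : Ω → ℝ) (hX : MemLp X 2 P) (hstable : α * (∫ ω, X ω ∂P) < β)
    (τ : ℕ → Ω → ℝ≥0) (ε : ℕ → Ω → Fin 2) (J : ℕ → Ω → ℝ)
    (hN : MarkedHawkes.IsMarkedHawkes P 𝓕 T (MarkedHawkes.expBaseline μ₀ κ)
      (MarkedHawkes.expExcitation α β) X τ ε J)
    (f₀ : ℝ) (EJ EJ2 C₁ C₂ C₃ C₄ : ℝ)
    (hEJ : EJ = ∫ ω, X ω ∂P) (hEJ2 : EJ2 = ∫ ω, X ω ^ 2 ∂P)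
    (hC₁ : C₁ = -(α ^ 2 * EJ ^ 2) /
      ((β - α * EJ) * (β + 3 * α * EJ) * (β - α * EJ + κ / T)))
    (hC₂ : C₂ = α ^ 2 * EJ ^ 2 * (β + 2 * α * EJ) /
      ((β + α * EJ) ^ 2 * (β + 3 * α * EJ) * (2 * β + 2 * α * EJ + κ / T)))
    (hC₃ : C₃ = α * β * EJ / ((β + α * EJ) ^ 2 * (β + α * EJ + κ / T)))
    (hC₄ : C₄ = β ^ 3 / (κ / T * (β + α * EJ) ^ 2 * (β - α * EJ)))
    (t : ℝ) (ht : t ∈ Set.Icc (0 : ℝ) T) :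
    Integrable (fun ω => MarkedHawkes.price f₀ τ ε J t ω ^ 2) P ∧
    ∫ ω, MarkedHawkes.price f₀ τ ε J t ω ^ 2 ∂P =
      f₀ ^ 2 + 2 * μ₀ * EJ2 *
        ((C₁ + C₂ + C₃ + C₄) * Real.exp (κ * (t / T))
          - C₁ * Real.exp (-(β - α * EJ) * t)
          - C₂ * Real.exp (-2 * (β + α * EJ) * t)
          - C₃ * Real.exp (-(β + α * EJ) * t)
          - C₄) := by

  subst hEJ hEJ2
  have hT' : (0 : ℝ) < T := hT
  have hEJ0 : 0 ≤ ∫ ω, X ω ∂P := integral_nonneg_of_ae (hN.ae_pos.mono fun _ h => h.le)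
  obtain ⟨h1, h2⟩ := hN.integral_price_sq hμ₀ hκ hα hβ hX f₀ ht
  refine ⟨h1, ?_⟩
  -- Stability enters as `a < β`, keeping `β - a` and `β - a + c` away from zero.
  rw [h2, hN.signedCross_move hμ₀ hκ hα hβ hX (c := κ / T) (a := α * ∫ ω, X ω ∂P) (C₁ := C₁)
    (C₂ := C₂) (C₃ := C₃) (C₄ := C₄) rfl rfl rfl (by positivity) (by positivity) hstable
    (by rw [hC₁]; ring_nf) (by rw [hC₂]; ring_nf) (by rw [hC₃]; ring_nf) (by rw [hC₄]) ht]
  have he1 : κ * (t / T) = κ / T * t := by ring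
  rw [he1, neg_sub]
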